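/- Let $q>0$, $q\ne 1$, $R>0$ be real, $N\ge 1$ and $M\ge 1$ integers, and put $[n]_q=\frac{q^{n/2}-q^{-n/2}}{q^{1/2}-q^{-1/2}}$, $C_N=\frac{[N]_q[N+2]_q}{[2]_q^2}$, $\Lambda_N=R\,\frac{[2]_{q^{N+1}}}{\sqrt{[N]_q[N+2]_q}}$. Indices $i,j,h,k$ run over $-1,0,1$ and repeated indices are summed. Let $\varepsilon^{1,0}_1=\varepsilon^{0,-1}_{-1}=q^{1/2}$, $\varepsilon^{0,1}_1=\varepsilon^{-1,0}_{-1}=-q^{-1/2}$, $\varepsilon^{0,0}_0=q^{1/2}-q^{-1/2}$, $\varepsilon^{1,-1}_0=1=-\varepsilon^{-1,1}_0$ and $g^{1,-1}=-q^{1/2}$, $g^{0,0}=1$, $g^{-1,1}=-q^{-1/2}$, all other components being $0$. Let $H=U_qso(3)$ be the Hopf algebra generated by $E^{\pm},q^{\pm H/2}$ with $q^{H/2}E^{\pm}=q^{\pm1}E^{\pm}q^{H/2}$, $q^{1/2}E^+E^--q^{-1/2}E^-E^+=\frac{q^{H}-1}{q^{1/2}-q^{-1/2}}$, $\Delta(E^\pm)=E^\pm\otimes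 q^{H/2}+1\otimes E^\pm$, $\Delta(q^{H/2})=q^{H/2}\otimes q^{H/2}$, antipode $S(E^\pm)=-E^\pm q^{-H/2}$, $S(q^{H/2})=q^{-H/2}$, and universal $R$-matrix ${\cal R}={\cal R}^{(1)}\otimes{\cal R}^{(2)}=q^{H\otimes H/4}\sum_{n\ge0}\frac{(q-1)^nq^{n(n-1)/4}}{[n]_q!}(E^+)^n\otimes(E^-q^{-H/2})^n$. Its vector representation $\rho$ has the nonzero matrix elements $\rho^{\pm1}_{\pm1}(q^{H/2})=q^{\pm1}$, $\rho^0_0(q^{H/2})=1$, $\rho^0_{-1}(E^+)=q^{-1/2}\sqrt{[2]_q}$, $\rho^1_0(E^+)=\rho^{-1}_0(E^-)=\sqrt{[2]_q}$, $\rho^0_1(E^-)=q^{1/2}\sqrt{[2]_q}$. Put ${\cal L}^{+\,i}{}_j={\cal R}^{(1)}\rho^i_j({\cal R}^{(2)})\in H$ and $\hat R^{ij}_{hk}=(\rho^j_h\otimes\rho^i_k)({\cal R})$. The $q$-deformed fuzzy sphere $\hat S^2_{q,N}$ is the algebra $Mat(N+1,\mathbb C)$ with the generators $x_{-1},x_0,x_1$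 given by $$\hat\varphi(E^+)=\tfrac1R\sqrt{q^{-1}[2]_qC_N}\,x_1,\quad \hat\varphi(E^-)=-\tfrac1R\sqrt{q[2]_qC_N}\,x_{-1},\quad \hat\varphi(q^{H/2})=\tfrac{[2]_{q^{N+1}}}{[2]_q}\Big(1-\tfrac{q^{1/2}-q^{-1/2}}{\Lambda_N}x_0\Big),$$ where $\hat\varphi:H\to Mat(N+1,\mathbb C)$ is the irreducible representation with basis $v_0,\dots,v_N$, $\hat\varphi(q^{H/2})v_b=q^{(N-2b)/2}v_b$, $\hat\varphi(E^-)v_b=\sqrt{[b+1]_q[N-b]_q}\,q^{(N-2b)/4}v_{b+1}$, $\hat\varphi(E^+)v_b=\sqrt{[b]_q[N-b+1]_q}\,q^{(N-2b)/4}v_{b-1}$; it is a left $H$-module algebra under $g\triangleright a=\hat\varphi(g_{(1)})\,a\,\hat\varphi(Sg_{(2)})$. Let ${\cal A}$ be the braided tensor product of $M$ copies ${\cal A}_1,\dots,{\cal A}_M$ of $\hat S^2_{q,N}$, i.e. the algebra generated by these copies with the cross relations $a_\beta a_\alpha=({\cal R}^{-1(1)}\triangleright a_\alpha)({\cal R}^{-1(2)}\triangleright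 a_\beta)$ for all $a_\alpha\in{\cal A}_\alpha$, $a_\beta\in{\cal A}_\beta$, $\alpha<\beta$. Let $x_{\alpha,i}$ be the generators of ${\cal A}_\alpha$, let $\hat\varphi_1$ be $\hat\varphi$ with values in ${\cal A}_1$, and put $$y_{1,i}=x_{1,i},\qquad y_{\alpha,i}=x_{\alpha,j}\,\hat\varphi_1({\cal L}^{+\,j}{}_i)\quad(\alpha>1).$$ Then $\varepsilon^{ij}_k\,y_{\alpha,i}y_{\alpha,j}=\Lambda_N\,y_{\alpha,k}$ and $g^{ij}\,y_{\alpha,i}y_{\alpha,j}=R^2$ for all $\alpha=1,\dots,M$ and all $k$; moreover $[y_{1,i},y_{\alpha,j}]=0$ for $\alpha>1$ and all $i,j$, and $y_{\alpha,i}\,y_{\beta,j}=\hat R^{hk}_{ij}\,y_{\beta,h}\,y_{\alpha,k}$ for $1<\alpha<\beta$ and all $i,j$. -/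

import Mathlib

open scoped TensorProduct Matrix

noncomputable section

namespace FuzzySphere

/-! ### Numerical parameters -/

/-- The parameters of the `q`-deformed fuzzy sphere: a positive real `q ≠ 1`, an integer `N ≥ 1`
and a radius `R > 0`. -/
structure Params where
  q : ℝ
  N : ℕ
  R : ℝ
  q_pos : 0 < q
  q_ne_one : q ≠ 1
  N_pos : 1 ≤ N
  R_pos : 0 < R

/-- The `q`-number `[n]_q = (q^(n/2) - q^(-n/2)) / (q^(1/2) - q^(-1/2))`. -/
def qnum (q n : ℝ) : ℝ :=
  (q ^ (n / 2) - q ^ (-(n / 2))) / (q ^ (1 / 2 : ℝ) - q ^ (-(1 / 2) : ℝ))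

/-- The `q`-factorial `[n]_q! = [1]_q [2]_q ⋯ [n]_q`. -/
def qfact (q : ℝ) (n : ℕ) : ℝ := ∏ k ∈ Finset.range n, qnum q (k + 1)

variable (p : Params)

/-- `q^(1/2)`. -/
def Params.s : ℝ := p.q ^ (1 / 2 : ℝ)

/-- `C_N = [N]_q [N+2]_q / [2]_q ^ 2`. -/
def Params.C : ℝ := qnum p.q p.N * qnum p.q (p.N + 2) / qnum p.q 2 ^ 2

/-- `Λ_N = R [2]_{q^(N+1)} / √([N]_q [N+2]_q)`. -/
def Params.Lam : ℝ :=
  p.R * (qnum (p.q ^ (p.N + 1)) 2 / √(qnum p.q p.N * qnum p.q (p.N + 2)))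

/-! Spin 1 tensors. The index values `-1, 0, 1` are represented by `0, 1, 2 : Fin 3`. -/

/-- The spin 1 Clebsch-Gordan coefficients, `eps p i j k` being `ε^{ij}_k`. -/
def eps : Fin 3 → Fin 3 → Fin 3 → ℝ
  | 2, 1, 2 => p.s
  | 1, 2, 2 => -p.s⁻¹
  | 1, 1, 1 => p.s - p.s⁻¹
  | 2, 0, 1 => 1
  | 0, 2, 1 => -1
  | 1, 0, 0 => p.s
  | 0, 1, 0 => -p.s⁻¹
  | _, _, _ => 0

/-- The invariant metric `g^{ij}` in the basis in which the Clebsch-Gordan coefficients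
are `eps`: `g^{1,-1} = -q^(1/2)`, `g^{0,0} = 1`, `g^{-1,1} = -q^(-1/2)`. -/
def metric : Fin 3 → Fin 3 → ℝ
  | 2, 0 => -p.s
  | 1, 1 => 1
  | 0, 2 => -p.s⁻¹
  | _, _ => 0

/-! ### The quantum group `H = U_q so(3)` -/

/-- Symbols for the generators `E^+ = X^+ q^(H/4)`, `E^- = X^- q^(H/4)`, `q^(H/2)`, `q^(-H/2)`. -/
inductive Gen
  | E | F | K | Ki

/-- The defining relations of `U_q so(3)`. The last one is `[X^+, X^-] = [H]_q`, written in terms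
of `E^± = X^± q^(H/4)`. -/
inductive URel : FreeAlgebra ℂ Gen → FreeAlgebra ℂ Gen → Prop
  | K_Ki : URel (FreeAlgebra.ι ℂ Gen.K * FreeAlgebra.ι ℂ Gen.Ki) 1
  | Ki_K : URel (FreeAlgebra.ι ℂ Gen.Ki * FreeAlgebra.ι ℂ Gen.K) 1
  | K_E : URel (FreeAlgebra.ι ℂ Gen.K * FreeAlgebra.ι ℂ Gen.E)
      ((p.q : ℂ) • (FreeAlgebra.ι ℂ Gen.E * FreeAlgebra.ι ℂ Gen.K))
  | K_F : URel (FreeAlgebra.ι ℂ Gen.K * FreeAlgebra.ι ℂ Gen.F)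
      ((p.q : ℂ)⁻¹ • (FreeAlgebra.ι ℂ Gen.F * FreeAlgebra.ι ℂ Gen.K))
  | E_F : URel
      ((p.s : ℂ) • (FreeAlgebra.ι ℂ Gen.E * FreeAlgebra.ι ℂ Gen.F)
        - (p.s : ℂ)⁻¹ • (FreeAlgebra.ι ℂ Gen.F * FreeAlgebra.ι ℂ Gen.E))
      (((p.s : ℂ) - (p.s : ℂ)⁻¹)⁻¹ • (FreeAlgebra.ι ℂ Gen.K * FreeAlgebra.ι ℂ Gen.K - 1))

/-- The algebra `U_q so(3)`. -/
def U : Type := RingQuot (URel p)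

instance : Ring (U p) := inferInstanceAs (Ring (RingQuot (URel p)))

instance : Algebra ℂ (U p) := inferInstanceAs (Algebra ℂ (RingQuot (URel p)))

/-- The quotient map from the free algebra. -/
def mkU : FreeAlgebra ℂ Gen →ₐ[ℂ] U p := RingQuot.mkAlgHom ℂ (URel p)

lemma mkU_rel {x y : FreeAlgebra ℂ Gen} (h : URel p x y) : mkU p x = mkU p y :=
  RingQuot.mkAlgHom_rel ℂ h

/-- The generators of `U_q so(3)`. -/
def gen (g : Gen) : U p := mkU p (FreeAlgebra.ι ℂ g)

lemma s_pos : 0 < p.s := Real.rpow_pos_of_pos p.q_pos _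

lemma s_sq : p.s * p.s = p.q := by
  rw [Params.s, ← Real.rpow_add p.q_pos]; norm_num

lemma s_ne : (p.s : ℂ) ≠ 0 := by exact_mod_cast (s_pos p).ne'

lemma q_eq : (p.q : ℂ) = p.s * p.s := by exact_mod_cast (s_sq p).symm

lemma gen_K_Ki : gen p .K * gen p .Ki = 1 := by
  simpa [gen, -Complex.coe_smul] using mkU_rel p URel.K_Ki

lemma gen_Ki_K : gen p .Ki * gen p .K = 1 := by
  simpa [gen, -Complex.coe_smul] using mkU_rel p URel.Ki_K

lemma gen_K_E : gen p .K * gen p .E = (p.q : ℂ) • (gen p .E * gen p .K) := by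
  simpa [gen, -Complex.coe_smul] using mkU_rel p URel.K_E

lemma gen_K_F : gen p .K * gen p .F = (p.q : ℂ)⁻¹ • (gen p .F * gen p .K) := by
  simpa [gen, -Complex.coe_smul] using mkU_rel p URel.K_F

lemma gen_E_F : (p.s : ℂ) • (gen p .E * gen p .F) - (p.s : ℂ)⁻¹ • (gen p .F * gen p .E)
    = ((p.s : ℂ) - (p.s : ℂ)⁻¹)⁻¹ • (gen p .K * gen p .K - 1) := by
  simpa [gen, -Complex.coe_smul] using mkU_rel p URel.E_F

/-- Universal property: elements of a `ℂ`-algebra that satisfy the defining relations define an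
algebra homomorphism from `U_q so(3)`. -/
def liftU {B : Type} [Ring B] [Algebra ℂ B] (E F K Ki : B)
    (h₁ : K * Ki = 1) (h₂ : Ki * K = 1)
    (h₃ : K * E = (p.q : ℂ) • (E * K)) (h₄ : K * F = (p.q : ℂ)⁻¹ • (F * K))
    (h₅ : (p.s : ℂ) • (E * F) - (p.s : ℂ)⁻¹ • (F * E)
      = ((p.s : ℂ) - (p.s : ℂ)⁻¹)⁻¹ • (K * K - 1)) : U p →ₐ[ℂ] B :=
  RingQuot.liftAlgHom ℂ
    ⟨FreeAlgebra.lift ℂ (fun g => match g with | .E => E | .F => F | .K => K | .Ki => Ki), by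
      intro x y h
      cases h
      · simpa [-Complex.coe_smul] using h₁
      · simpa [-Complex.coe_smul] using h₂
      · simpa [-Complex.coe_smul] using h₃
      · simpa [-Complex.coe_smul] using h₄
      · simpa [-Complex.coe_smul] using h₅⟩

lemma liftU_gen {B : Type} [Ring B] [Algebra ℂ B] (E F K Ki : B) (h₁ h₂ h₃ h₄ h₅) (g : Gen) :
    liftU p E F K Ki h₁ h₂ h₃ h₄ h₅ (gen p g)
      = match g with | .E => E | .F => F | .K => K | .Ki => Ki :=
  (RingQuot.liftAlgHom_mkAlgHom_apply ℂ _ _ _).trans (FreeAlgebra.lift_ι_apply _ _)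

/-- `q^(H/2)` as a unit of `U_q so(3)`. -/
def Kunit : (U p)ˣ := ⟨gen p .K, gen p .Ki, gen_K_Ki p, gen_Ki_K p⟩

/-- The coproduct: `Δ(E^±) = E^± ⊗ q^(H/2) + 1 ⊗ E^±`, `Δ(q^(±H/2)) = q^(±H/2) ⊗ q^(±H/2)`. -/
def comul : U p →ₐ[ℂ] U p ⊗[ℂ] U p :=
  liftU p (gen p .E ⊗ₜ gen p .K + 1 ⊗ₜ gen p .E) (gen p .F ⊗ₜ gen p .K + 1 ⊗ₜ gen p .F)
    (gen p .K ⊗ₜ gen p .K) (gen p .Ki ⊗ₜ gen p .Ki)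
    (by simp [gen_K_Ki, Algebra.TensorProduct.one_def])
    (by simp [gen_Ki_K, Algebra.TensorProduct.one_def])
    (by simp [mul_add, add_mul, gen_K_E, TensorProduct.smul_tmul'])
    (by simp [mul_add, add_mul, gen_K_F, TensorProduct.smul_tmul'])
    (by
      have hs := s_ne p
      have hEF : gen p .E * gen p .F = (p.s : ℂ)⁻¹ • ((p.s : ℂ)⁻¹ • (gen p .F * gen p .E)
          + ((p.s : ℂ) - (p.s : ℂ)⁻¹)⁻¹ • (gen p .K * gen p .K - 1)) := by
        rw [← gen_E_F, add_sub_cancel, smul_smul, inv_mul_cancel₀ hs, one_smul]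
      simp only [mul_add, add_mul, Algebra.TensorProduct.tmul_mul_tmul, one_mul, mul_one,
        gen_K_E, gen_K_F, TensorProduct.tmul_smul, smul_add, hEF, q_eq,
        TensorProduct.tmul_add, TensorProduct.add_tmul, ← TensorProduct.smul_tmul', smul_smul,
        TensorProduct.tmul_sub, TensorProduct.sub_tmul, smul_sub,
        Algebra.TensorProduct.one_def]
      match_scalars <;> field_simp <;> ring)

lemma gen_Ki_E : gen p .Ki * gen p .E = (p.q : ℂ)⁻¹ • (gen p .E * gen p .Ki) := by
  have hq : (p.q : ℂ) ≠ 0 := by exact_mod_cast p.q_pos.ne'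
  have h := congrArg (fun t => gen p .Ki * t * gen p .Ki) (gen_K_E p)
  simp only [mul_smul_comm, smul_mul_assoc] at h
  rw [← mul_assoc, gen_Ki_K, one_mul, mul_assoc (gen p .Ki), mul_assoc (gen p .E), gen_K_Ki,
    mul_one] at h
  rw [h, smul_smul, inv_mul_cancel₀ hq, one_smul]

lemma gen_Ki_F : gen p .Ki * gen p .F = (p.q : ℂ) • (gen p .F * gen p .Ki) := by
  have hq : (p.q : ℂ) ≠ 0 := by exact_mod_cast p.q_pos.ne'
  have h := congrArg (fun t => gen p .Ki * t * gen p .Ki) (gen_K_F p)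
  simp only [mul_smul_comm, smul_mul_assoc] at h
  rw [← mul_assoc, gen_Ki_K, one_mul, mul_assoc (gen p .Ki), mul_assoc (gen p .F), gen_K_Ki,
    mul_one] at h
  rw [h, smul_smul, mul_inv_cancel₀ hq, one_smul]

/-- The antipode, as an algebra homomorphism to the opposite algebra: `S(E^±) = -E^± q^(-H/2)`,
`S(q^(±H/2)) = q^(∓H/2)`. -/
def antipodeHom : U p →ₐ[ℂ] (U p)ᵐᵒᵖ :=
  liftU p (MulOpposite.op (-(gen p .E * gen p .Ki))) (MulOpposite.op (-(gen p .F * gen p .Ki)))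
    (MulOpposite.op (gen p .Ki)) (MulOpposite.op (gen p .K))
    (by rw [← MulOpposite.op_mul, gen_K_Ki]; rfl)
    (by rw [← MulOpposite.op_mul, gen_Ki_K]; rfl)
    (by
      have hq : (p.q : ℂ) ≠ 0 := by exact_mod_cast p.q_pos.ne'
      rw [← MulOpposite.op_mul, ← MulOpposite.op_mul, ← MulOpposite.op_smul]
      congr 1
      rw [mul_neg, ← mul_assoc, gen_Ki_E, smul_mul_assoc, ← smul_neg, smul_smul,
        mul_inv_cancel₀ hq, one_smul, neg_mul])
    (by
      have hq : (p.q : ℂ) ≠ 0 := by exact_mod_cast p.q_pos.ne'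
      rw [← MulOpposite.op_mul, ← MulOpposite.op_mul, ← MulOpposite.op_smul]
      congr 1
      rw [mul_neg, ← mul_assoc, gen_Ki_F, smul_mul_assoc, ← smul_neg, smul_smul,
        inv_mul_cancel₀ hq, one_smul, neg_mul])
    (by
      have hs := s_ne p
      simp only [← MulOpposite.op_mul, ← MulOpposite.op_smul, ← MulOpposite.op_sub,
        ← MulOpposite.op_one]
      congr 1
      have h₁ : gen p .F * gen p .Ki * (gen p .E * gen p .Ki)
          = (p.q : ℂ)⁻¹ • (gen p .F * gen p .E * (gen p .Ki * gen p .Ki)) := by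
        rw [mul_assoc, ← mul_assoc (gen p .Ki), gen_Ki_E]
        simp only [smul_mul_assoc, mul_smul_comm, mul_assoc]
      have h₂ : gen p .E * gen p .Ki * (gen p .F * gen p .Ki)
          = (p.q : ℂ) • (gen p .E * gen p .F * (gen p .Ki * gen p .Ki)) := by
        rw [mul_assoc, ← mul_assoc (gen p .Ki), gen_Ki_F]
        simp only [smul_mul_assoc, mul_smul_comm, mul_assoc]
      have h₃ : (gen p .K * gen p .K - 1) * (gen p .Ki * gen p .Ki)
          = 1 - gen p .Ki * gen p .Ki := by
        rw [sub_mul, one_mul, mul_assoc, ← mul_assoc (gen p .K) (gen p .Ki), gen_K_Ki, one_mul,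
          gen_K_Ki]
      have h₄ := congrArg (· * (gen p .Ki * gen p .Ki)) (gen_E_F p)
      simp only [sub_mul _ _ (gen p .Ki * gen p .Ki), smul_mul_assoc] at h₄
      rw [← sub_mul, h₃] at h₄
      rw [neg_mul_neg, neg_mul_neg, h₁, h₂, ← neg_sub (1 : U p), smul_neg, ← h₄, neg_sub,
        smul_smul, smul_smul, q_eq]
      congr 2 <;> field_simp)

/-- The antipode `S` of `U_q so(3)` as a linear map. -/
def antipode : U p →ₗ[ℂ] U p :=
  (MulOpposite.opLinearEquiv ℂ).symm.toLinearMap ∘ₗ (antipodeHom p).toLinearMap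

/-- `[2]_q ^ (1/2)`. -/
def Params.r : ℝ := √(qnum p.q 2)

lemma s_sub_ne : p.s - p.s⁻¹ ≠ 0 := by
  have hs := s_pos p
  intro h
  have h1 : p.s * p.s = 1 := by
    field_simp at h
    nlinarith
  exact p.q_ne_one (by rw [← s_sq, h1])

lemma qnum_eq (n : ℝ) :
    qnum p.q n = (p.q ^ (n / 2) - p.q ^ (-(n / 2))) * (p.s - p.s⁻¹)⁻¹ := by
  rw [qnum, div_eq_mul_inv, Params.s, ← Real.rpow_neg p.q_pos.le]

lemma qnum_two : qnum p.q 2 = p.s + p.s⁻¹ := by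
  have h := s_sub_ne p
  have hs := (s_pos p).ne'
  rw [qnum_eq, Real.rpow_neg p.q_pos.le]
  norm_num
  rw [← s_sq]
  rw [← div_eq_mul_inv, div_eq_iff h]
  field_simp
  ring

lemma r_sq : p.r * p.r = p.s + p.s⁻¹ := by
  rw [Params.r, ← qnum_two, Real.mul_self_sqrt]
  rw [qnum_two]
  have := s_pos p
  positivity

/-- The fundamental vector (spin 1) representation `ρ`; the matrix entry in row `i` and column `j`
is `ρ^i_j`, and the index values `-1, 0, 1` are represented by `0, 1, 2 : Fin 3`. -/
def vecRep : U p →ₐ[ℂ] Matrix (Fin 3) (Fin 3) ℂ :=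
  liftU p
    !![0, 0, 0; (p.r * p.s⁻¹ : ℝ), 0, 0; 0, (p.r : ℝ), 0]
    !![0, (p.r : ℝ), 0; 0, 0, (p.r * p.s : ℝ); 0, 0, 0]
    !![(p.q : ℂ)⁻¹, 0, 0; 0, 1, 0; 0, 0, (p.q : ℂ)]
    !![(p.q : ℂ), 0, 0; 0, 1, 0; 0, 0, (p.q : ℂ)⁻¹]
    (by
      have hq : (p.q : ℂ) ≠ 0 := by exact_mod_cast p.q_pos.ne'
      ext i j; fin_cases i <;> fin_cases j <;> simp [Matrix.mul_apply, Fin.sum_univ_three, hq])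
    (by
      have hq : (p.q : ℂ) ≠ 0 := by exact_mod_cast p.q_pos.ne'
      ext i j; fin_cases i <;> fin_cases j <;> simp [Matrix.mul_apply, Fin.sum_univ_three, hq])
    (by
      have hq : (p.q : ℂ) ≠ 0 := by exact_mod_cast p.q_pos.ne'
      ext i j; fin_cases i <;> fin_cases j <;>
        simp [Matrix.mul_apply, Fin.sum_univ_three, -Complex.coe_smul] <;> field_simp)
    (by
      have hq : (p.q : ℂ) ≠ 0 := by exact_mod_cast p.q_pos.ne'
      ext i j; fin_cases i <;> fin_cases j <;>
        simp [Matrix.mul_apply, Fin.sum_univ_three, -Complex.coe_smul] <;> field_simp)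
    (by
      have hs := s_ne p
      have hr : (p.r : ℂ) * p.r = p.s + (p.s : ℂ)⁻¹ := by exact_mod_cast r_sq p
      have hd : (p.s : ℂ) - (p.s : ℂ)⁻¹ ≠ 0 := by exact_mod_cast s_sub_ne p
      have hr2 : (p.r : ℂ) ^ 2 = p.s + (p.s : ℂ)⁻¹ := by rw [sq, hr]
      ext i j; fin_cases i <;> fin_cases j <;>
        simp [-Complex.coe_smul, q_eq] <;>
        apply mul_left_cancel₀ hd <;> (try rw [mul_inv_cancel_left₀ hd]) <;> ring_nf <;>
        (try simp only [hr2]) <;> field_simp <;> ring)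

/-! ### The `q`-deformed fuzzy sphere -/

/-- The underlying algebra `Mat(N+1)` of the `q`-deformed fuzzy sphere. -/
abbrev Mat : Type := Matrix (Fin (p.N + 1)) (Fin (p.N + 1)) ℂ

/-- The generators `x_{-1}, x_0, x_1` of the fuzzy sphere, in the basis of `ℂ^(N+1)` in which
`q^(H/2)` acts by the diagonal matrix with entries `q^((N-2b)/2)`, `b = 0, …, N`. -/
def x : Fin 3 → Mat p
  | 0 => Matrix.of fun a b : Fin (p.N + 1) => if (a : ℕ) = b + 1 then
      ((-(p.R * √(qnum p.q 2 / (p.q * (qnum p.q p.N * qnum p.q (p.N + 2)))))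
        * (√(qnum p.q (b + 1) * qnum p.q (p.N - b)) * p.q ^ ((p.N - 2 * b : ℝ) / 4)) : ℝ) : ℂ)
      else 0
  | 1 => Matrix.diagonal fun b : Fin (p.N + 1) =>
      ((p.R / (√(qnum p.q p.N * qnum p.q (p.N + 2)) * (p.s - p.s⁻¹))
        * (qnum (p.q ^ (p.N + 1)) 2 - qnum p.q 2 * p.q ^ ((p.N - 2 * b : ℝ) / 2)) : ℝ) : ℂ)
  | 2 => Matrix.of fun a b : Fin (p.N + 1) => if (a : ℕ) + 1 = b then
      ((p.R * √(p.q * qnum p.q 2 / (qnum p.q p.N * qnum p.q (p.N + 2)))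
        * (√(qnum p.q b * qnum p.q (p.N - b + 1)) * p.q ^ ((p.N - 2 * b : ℝ) / 4)) : ℝ) : ℂ)
      else 0

/-- `φ(E^+) = R⁻¹ √(q⁻¹ [2]_q C_N) x_1`. -/
def phiE : Mat p := ((1 / p.R * √(p.q⁻¹ * qnum p.q 2 * p.C) : ℝ) : ℂ) • x p 2

/-- `φ(E^-) = -R⁻¹ √(q [2]_q C_N) x_{-1}`. -/
def phiF : Mat p := ((-(1 / p.R * √(p.q * qnum p.q 2 * p.C)) : ℝ) : ℂ) • x p 0

/-- `φ(q^(H/2)) = [2]_{q^(N+1)} / [2]_q * (1 - (q^(1/2) - q^(-1/2)) / Λ_N * x_0)`. -/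
def phiK : Mat p := ((qnum (p.q ^ (p.N + 1)) 2 / qnum p.q 2 : ℝ) : ℂ) •
  (1 - (((p.s - p.s⁻¹) / p.Lam : ℝ) : ℂ) • x p 1)

lemma qnum_pos {n : ℝ} (hn : 0 < n) : 0 < qnum p.q n := by
  rw [qnum]
  rcases lt_or_gt_of_ne p.q_ne_one with h | h
  · exact div_pos_of_neg_of_neg
      (sub_neg.2 (Real.rpow_lt_rpow_of_exponent_gt p.q_pos h (by linarith)))
      (sub_neg.2 (Real.rpow_lt_rpow_of_exponent_gt p.q_pos h (by norm_num)))
  · exact div_pos (sub_pos.2 (Real.rpow_lt_rpow_of_exponent_lt h (by linarith)))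
      (sub_pos.2 (Real.rpow_lt_rpow_of_exponent_lt h (by norm_num)))

lemma qnum_nonneg {n : ℝ} (hn : 0 ≤ n) : 0 ≤ qnum p.q n := by
  rcases hn.eq_or_lt with h | h
  · rw [← h]; simp [qnum]
  · exact (qnum_pos p h).le

lemma qN_pos : 0 < qnum p.q p.N := qnum_pos p (by exact_mod_cast p.N_pos)

lemma qN2_pos : 0 < qnum p.q (p.N + 2) := qnum_pos p (by positivity)

lemma q2_pos : 0 < qnum p.q 2 := qnum_pos p (by norm_num)

lemma qbig_pos : 0 < qnum (p.q ^ (p.N + 1)) 2 := by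
  have h : p.q ^ (p.N + 1) ≠ 1 := by
    intro h
    exact p.q_ne_one ((pow_eq_one_iff_of_nonneg p.q_pos.le (by omega)).1 h)
  exact qnum_pos ⟨p.q ^ (p.N + 1), p.N, p.R, pow_pos p.q_pos _, h, p.N_pos, p.R_pos⟩ (by norm_num)

lemma Lam_pos : 0 < p.Lam :=
  mul_pos p.R_pos (div_pos (qbig_pos p) (Real.sqrt_pos.2 (mul_pos (qN_pos p) (qN2_pos p))))

lemma phiE_eq : phiE p = Matrix.of fun a b : Fin (p.N + 1) => if (a : ℕ) + 1 = b then
    ((√(qnum p.q b * qnum p.q (p.N - b + 1)) * p.q ^ ((p.N - 2 * b : ℝ) / 4) : ℝ) : ℂ)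
    else 0 := by
  have hc : 1 / p.R * √(p.q⁻¹ * qnum p.q 2 * p.C)
      * (p.R * √(p.q * qnum p.q 2 / (qnum p.q p.N * qnum p.q (p.N + 2)))) = 1 := by
    have h1 := qN_pos p
    have h2 := qN2_pos p
    have h3 := q2_pos p
    have h4 := p.R_pos
    have h5 := p.q_pos
    have : √(p.q⁻¹ * qnum p.q 2 * p.C)
        * √(p.q * qnum p.q 2 / (qnum p.q p.N * qnum p.q (p.N + 2))) = 1 := by
      rw [← Real.sqrt_mul (by rw [Params.C]; positivity), Real.sqrt_eq_one, Params.C]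
      field_simp
    calc _ = p.R / p.R * (√(p.q⁻¹ * qnum p.q 2 * p.C)
        * √(p.q * qnum p.q 2 / (qnum p.q p.N * qnum p.q (p.N + 2)))) := by ring
      _ = 1 := by rw [this, div_self h4.ne', one_mul]
  ext a b
  simp only [phiE, x, Matrix.smul_apply, Matrix.of_apply, smul_eq_mul, mul_ite, mul_zero]
  split_ifs
  · rw [← Complex.ofReal_mul, ← mul_assoc, hc, one_mul]
  · rfl

lemma phiF_eq : phiF p = Matrix.of fun a b : Fin (p.N + 1) => if (a : ℕ) = b + 1 then
    ((√(qnum p.q (b + 1) * qnum p.q (p.N - b)) * p.q ^ ((p.N - 2 * b : ℝ) / 4) : ℝ) : ℂ)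
    else 0 := by
  have hc : -(1 / p.R * √(p.q * qnum p.q 2 * p.C))
      * (-(p.R * √(qnum p.q 2 / (p.q * (qnum p.q p.N * qnum p.q (p.N + 2)))))) = 1 := by
    have h1 := qN_pos p
    have h2 := qN2_pos p
    have h3 := q2_pos p
    have h4 := p.R_pos
    have h5 := p.q_pos
    have : √(p.q * qnum p.q 2 * p.C)
        * √(qnum p.q 2 / (p.q * (qnum p.q p.N * qnum p.q (p.N + 2)))) = 1 := by
      rw [← Real.sqrt_mul (by rw [Params.C]; positivity), Real.sqrt_eq_one, Params.C]
      field_simp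
    calc _ = p.R / p.R * (√(p.q * qnum p.q 2 * p.C)
        * √(qnum p.q 2 / (p.q * (qnum p.q p.N * qnum p.q (p.N + 2))))) := by ring
      _ = 1 := by rw [this, div_self h4.ne', one_mul]
  ext a b
  simp only [phiF, x, Matrix.smul_apply, Matrix.of_apply, smul_eq_mul, mul_ite, mul_zero]
  split_ifs
  · rw [← Complex.ofReal_mul, ← mul_assoc, hc, one_mul]
  · rfl

lemma phiK_eq : phiK p =
    Matrix.diagonal fun b : Fin (p.N + 1) => ((p.q ^ ((p.N - 2 * b : ℝ) / 2) : ℝ) : ℂ) := by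
  have h1 := Real.sqrt_pos.2 (mul_pos (qN_pos p) (qN2_pos p))
  have h3 := (q2_pos p).ne'
  have h4 := p.R_pos.ne'
  have h5 := (qbig_pos p).ne'
  have h6 := s_sub_ne p
  ext a b
  rcases eq_or_ne a b with rfl | hab
  · simp only [phiK, x, Matrix.smul_apply, Matrix.sub_apply, Matrix.one_apply_eq,
      Matrix.diagonal_apply_eq, smul_eq_mul]
    rw [← Complex.ofReal_one, ← Complex.ofReal_mul, ← Complex.ofReal_sub, ← Complex.ofReal_mul]
    congr 1
    rw [Params.Lam]
    generalize √(qnum p.q p.N * qnum p.q (p.N + 2)) = u at *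
    have h1' := h1.ne'
    generalize p.s - p.s⁻¹ = d at *
    field_simp
    ring
  · simp [phiK, x, hab]

lemma phiK_isUnit : IsUnit (phiK p).det := by
  rw [phiK_eq, Matrix.det_diagonal, isUnit_iff_ne_zero, Finset.prod_ne_zero_iff]
  intro i _
  exact_mod_cast (Real.rpow_pos_of_pos p.q_pos _).ne'

lemma phiE_mul_phiF : phiE p * phiF p = Matrix.diagonal fun b : Fin (p.N + 1) =>
    ((qnum p.q (b + 1) * qnum p.q (p.N - b) * p.q ^ ((p.N - 2 * b - 1 : ℝ) / 2) : ℝ) : ℂ) := by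
  ext a b
  rw [phiE_eq, phiF_eq, Matrix.mul_apply]
  simp only [Matrix.of_apply]
  rcases eq_or_ne a b with rfl | hab
  · rw [Matrix.diagonal_apply_eq]
    rcases Nat.lt_or_ge (a : ℕ) p.N with ha | ha
    · rw [Finset.sum_eq_single (⟨a + 1, by omega⟩ : Fin (p.N + 1))]
      · simp only [if_true]
        rw [← Complex.ofReal_mul]
        congr 1
        have h1 : (0 : ℝ) ≤ qnum p.q (a + 1) := qnum_nonneg p (by positivity)
        have h2 : (0 : ℝ) ≤ qnum p.q (p.N - a) :=
          qnum_nonneg p (sub_nonneg.2 (by exact_mod_cast ha.le))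
        push_cast
        rw [show (p.N : ℝ) - (a + 1) + 1 = p.N - a by ring, mul_mul_mul_comm,
          Real.mul_self_sqrt (mul_nonneg h1 h2), ← Real.rpow_add p.q_pos]
        congr 2
        ring
      · intro c _ hc
        rw [if_neg, zero_mul]
        intro h
        exact hc (Fin.ext h.symm)
      · simp
    · have : (a : ℕ) = p.N := by omega
      rw [Finset.sum_eq_zero]
      · simp [this, qnum]
      · intro c _
        rw [if_neg (by omega), zero_mul]
  · rw [Matrix.diagonal_apply_ne _ hab]
    refine Finset.sum_eq_zero fun c _ => ?_
    split_ifs with h1 h2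
    · exact absurd (Fin.ext (by omega)) hab
    all_goals simp

lemma phiF_mul_phiE : phiF p * phiE p = Matrix.diagonal fun b : Fin (p.N + 1) =>
    ((qnum p.q b * qnum p.q (p.N - b + 1) * p.q ^ ((p.N - 2 * b + 1 : ℝ) / 2) : ℝ) : ℂ) := by
  ext a b
  rw [phiE_eq, phiF_eq, Matrix.mul_apply]
  simp only [Matrix.of_apply]
  rcases eq_or_ne a b with rfl | hab
  · rw [Matrix.diagonal_apply_eq]
    rcases Nat.eq_zero_or_pos (a : ℕ) with ha | ha
    · rw [Finset.sum_eq_zero]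
      · simp [ha, qnum]
      · intro c _
        rw [if_neg (by omega), zero_mul]
    · obtain ⟨k, hk⟩ : ∃ k : ℕ, (a : ℕ) = k + 1 := ⟨a - 1, by omega⟩
      rw [Finset.sum_eq_single (⟨k, by omega⟩ : Fin (p.N + 1))]
      · simp only [hk, if_true]
        rw [← Complex.ofReal_mul]
        congr 1
        have h1 : (0 : ℝ) ≤ qnum p.q (k + 1) := qnum_nonneg p (by positivity)
        have h2 : (0 : ℝ) ≤ qnum p.q (p.N - k) :=
          qnum_nonneg p (sub_nonneg.2 (by exact_mod_cast (by omega : k ≤ p.N)))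
        push_cast
        rw [show (p.N : ℝ) - (k + 1) + 1 = p.N - k by ring, mul_mul_mul_comm,
          Real.mul_self_sqrt (mul_nonneg h1 h2), ← Real.rpow_add p.q_pos]
        congr 2
        ring
      · intro c _ hc
        rw [if_neg, zero_mul]
        intro h
        exact hc (Fin.ext (by simp only; omega))
      · simp
  · rw [Matrix.diagonal_apply_ne _ hab]
    refine Finset.sum_eq_zero fun c _ => ?_
    split_ifs with h1 h2
    · exact absurd (Fin.ext (by omega)) hab
    all_goals simp

lemma qnum_identity (a b : ℝ) :
    p.s * (qnum p.q (a + 1) * qnum p.q (b - a) * p.q ^ ((b - 2 * a - 1 : ℝ) / 2))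
      - p.s⁻¹ * (qnum p.q a * qnum p.q (b - a + 1) * p.q ^ ((b - 2 * a + 1 : ℝ) / 2))
    = (p.s - p.s⁻¹)⁻¹ * (p.q ^ ((b - 2 * a) / 2) * p.q ^ ((b - 2 * a) / 2) - 1) := by
  have hs := (s_pos p).ne'
  have hd := s_sub_ne p
  have hq := p.q_pos
  have hA : 0 < p.q ^ (a / 2) := Real.rpow_pos_of_pos hq _
  have hB : 0 < p.q ^ (b / 2) := Real.rpow_pos_of_pos hq _
  have e1 : p.q ^ ((a + 1) / 2) = p.q ^ (a / 2) * p.s := by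
    rw [Params.s, ← Real.rpow_add hq]; congr 1; ring
  have e2 : p.q ^ ((b - a) / 2) = p.q ^ (b / 2) / p.q ^ (a / 2) := by
    rw [← Real.rpow_sub hq]; congr 1; ring
  have e3 : p.q ^ ((b - a + 1) / 2) = p.q ^ (b / 2) / p.q ^ (a / 2) * p.s := by
    rw [Params.s, ← Real.rpow_sub hq, ← Real.rpow_add hq]; congr 1; ring
  have e4 : p.q ^ ((b - 2 * a) / 2) = p.q ^ (b / 2) / p.q ^ (a / 2) / p.q ^ (a / 2) := by
    rw [← Real.rpow_sub hq, ← Real.rpow_sub hq]; congr 1; ring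
  have e5 : p.q ^ ((b - 2 * a - 1) / 2) = p.q ^ (b / 2) / p.q ^ (a / 2) / p.q ^ (a / 2) / p.s := by
    rw [Params.s, ← Real.rpow_sub hq, ← Real.rpow_sub hq, ← Real.rpow_sub hq]; congr 1; ring
  have e6 : p.q ^ ((b - 2 * a + 1) / 2) = p.q ^ (b / 2) / p.q ^ (a / 2) / p.q ^ (a / 2) * p.s := by
    rw [Params.s, ← Real.rpow_sub hq, ← Real.rpow_sub hq, ← Real.rpow_add hq]; congr 1; ring
  simp only [qnum_eq, Real.rpow_neg hq.le, e1, e2, e3, e4, e5, e6]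
  generalize p.q ^ (a / 2) = A at *
  generalize p.q ^ (b / 2) = B at *
  generalize p.s = s at *
  have hd2 : s ^ 2 - 1 ≠ 0 := by
    intro h
    apply hd
    field_simp
    linarith
  have hd3 : s - s⁻¹ = (s ^ 2 - 1) / s := by field_simp
  rw [hd3]
  field_simp
  ring

/-- The algebra homomorphism `φ : U_q so(3) → Mat(N+1)`. -/
def phi : U p →ₐ[ℂ] Mat p :=
  liftU p (phiE p) (phiF p) (phiK p) (phiK p)⁻¹
    (Matrix.mul_nonsing_inv _ (phiK_isUnit p))
    (Matrix.nonsing_inv_mul _ (phiK_isUnit p))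
    (by
      rw [phiK_eq, phiE_eq]
      ext a b
      rw [Matrix.diagonal_mul, Matrix.smul_apply, Matrix.mul_diagonal, Matrix.of_apply]
      split_ifs with h
      · have : p.q ^ ((p.N - 2 * a : ℝ) / 2) = p.q * p.q ^ ((p.N - 2 * b : ℝ) / 2) := by
          rw [← h]
          nth_rewrite 2 [← Real.rpow_one p.q]
          rw [← Real.rpow_add p.q_pos]
          congr 1
          push_cast
          ring
        rw [this, smul_eq_mul]
        push_cast
        ring
      · simp)
    (by
      rw [phiK_eq, phiF_eq]
      ext a b
      rw [Matrix.diagonal_mul, Matrix.smul_apply, Matrix.mul_diagonal, Matrix.of_apply]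
      split_ifs with h
      · have : p.q ^ ((p.N - 2 * a : ℝ) / 2) = p.q⁻¹ * p.q ^ ((p.N - 2 * b : ℝ) / 2) := by
          rw [h, ← Real.rpow_neg_one p.q, ← Real.rpow_add p.q_pos]
          congr 1
          push_cast
          ring
        rw [this, smul_eq_mul]
        push_cast
        ring
      · simp)
    (by
      rw [phiE_mul_phiF, phiF_mul_phiE, phiK_eq, Matrix.diagonal_mul_diagonal]
      ext a b
      rcases eq_or_ne a b with rfl | hab
      · simp only [Matrix.sub_apply, Matrix.smul_apply, Matrix.diagonal_apply_eq, smul_eq_mul,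
          Matrix.one_apply_eq]
        exact_mod_cast qnum_identity p a p.N
      · simp [hab])

/-- Left multiplication `a ↦ φ(g) a`. -/
def actL : U p →ₐ[ℂ] Module.End ℂ (Mat p) := (Algebra.lsmul ℂ ℂ (Mat p)).comp (phi p)

/-- Right multiplication `a ↦ a φ(S g)`. -/
def actR : U p →ₐ[ℂ] Module.End ℂ (Mat p) :=
  (Algebra.lsmul ℂ ℂ (Mat p)).comp ((AlgHom.op (phi p)).comp (antipodeHom p))

lemma actL_commute (g h : U p) : Commute (actL p g) (actR p h) := by
  ext1 a
  simp [actL, actR, mul_assoc]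

/-- The left action of `H = U_q so(3)` on the fuzzy sphere: the adjoint action
`g ▷ a = φ(g_(1)) a φ(S g_(2))`, so that `φ(g) a = (g_(1) ▷ a) φ(g_(2))`. -/
def act : U p →ₐ[ℂ] Module.End ℂ (Mat p) :=
  (Algebra.TensorProduct.lift (actL p) (actR p) (actL_commute p)).comp (comul p)

/-! ### The universal R-matrix -/

/-- The spectral projection of `q^(H/2)` onto the eigenvalue `q^m`, valid in any representation in
which `q^(H/2)` is diagonalizable with eigenvalues `q^j`, `|j| ≤ d`. -/
def wtProj (d : ℕ) (m : ℤ) : U p :=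
  Polynomial.aeval (gen p .K)
    (Lagrange.basis (Finset.Icc (-(d : ℤ)) d) (fun j : ℤ => (p.q : ℂ) ^ j) m)

/-- The universal R-matrix of `U_q so(3)`,
`ℛ = q^(H⊗H/4) ∑ₙ (q-1)ⁿ q^(n(n-1)/4) / [n]_q! (E^+)ⁿ ⊗ (E^- q^(-H/2))ⁿ`,
as an element of `H ⊗ H` that acts as `ℛ` on `V ⊗ W` for every representation `V` and every
finite-dimensional representation `W` in which `q^(H/2)` is diagonalizable with eigenvalues `q^m`,
`|m| ≤ d`: there `(E^-)ⁿ = 0` for `n > 2d`, and `q^(H⊗H/4)` is `∑ₘ q^(mH/2) ⊗ Pₘ`, with `Pₘ` the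
projection onto the eigenspace of `q^(H/2)` of eigenvalue `q^m`. -/
def univR (d : ℕ) : U p ⊗[ℂ] U p :=
  ∑ n ∈ Finset.range (2 * d + 1), ∑ m ∈ Finset.Icc (-(d : ℤ)) d,
    (((p.q - 1) ^ n * p.q ^ ((n * (n - 1) : ℝ) / 4) / qfact p.q n : ℝ) : ℂ) •
      ((((Kunit p ^ m : (U p)ˣ) : U p) * gen p .E ^ n) ⊗ₜ[ℂ]
        (wtProj p d m * (gen p .F * gen p .Ki) ^ n))

/-- The matrix coefficient `ρ^i_j` of the vector representation. -/
def rho (i j : Fin 3) : U p →ₗ[ℂ] ℂ :=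
  Matrix.entryLinearMap ℂ ℂ i j ∘ₗ (vecRep p).toLinearMap

/-- The Faddeev-Reshetikhin-Takhtajan generators `L⁺^i_j = ℛ^(1) ρ^i_j(ℛ^(2))`. -/
def Lplus (i j : Fin 3) : U p :=
  TensorProduct.rid ℂ (U p) ((rho p i j).lTensor (U p) (univR p 1))

/-- The braid matrix `R̂^{ij}_{hk} = (ρ^j_h ⊗ ρ^i_k)(ℛ)`. -/
def Rhat (i j h k : Fin 3) : ℂ :=
  LinearMap.mul' ℂ ℂ (TensorProduct.map (rho p j h) (rho p i k) (univR p 1))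

/-! ### The braided tensor product of `M` copies of the fuzzy sphere -/

/-- The free product of `M` copies of the fuzzy sphere. -/
abbrev Free (M : ℕ) : Type := LinearAlgebra.FreeProduct ℂ (fun _ : Fin M => Mat p)

/-- The inclusion of the `α`-th copy in the free product. -/
def incl (M : ℕ) (α : Fin M) : Mat p →ₐ[ℂ] Free p M :=
  LinearAlgebra.FreeProduct.ι ℂ (fun _ : Fin M => Mat p) α

/-- The cross relations `a₂ a₁ = (ℛ^(-1)(1) ▷ a₁) (ℛ^(-1)(2) ▷ a₂)`, `a₁` in the `α`-th and `a₂` in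
the `β`-th copy, `α < β`, where `ℛ⁻¹ = (S ⊗ id) ℛ`. The eigenvalues of `q^(H/2)` on the fuzzy
sphere are `q^m`, `|m| ≤ N`. -/
inductive BraidRel (M : ℕ) : Free p M → Free p M → Prop
  | cross (α β : Fin M) (h : α < β) (a₁ a₂ : Mat p) :
      BraidRel M (incl p M β a₂ * incl p M α a₁)
        (LinearMap.mul' ℂ (Free p M)
          (TensorProduct.map
            ((incl p M α).toLinearMap ∘ₗ (act p).toLinearMap.flip a₁ ∘ₗ antipode p)
            ((incl p M β).toLinearMap ∘ₗ (act p).toLinearMap.flip a₂)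
            (univR p p.N)))

/-- The braided tensor product of `M` copies of the fuzzy sphere: the algebra generated by the `M`
copies subject to the cross relations. -/
abbrev Braided (M : ℕ) : Type := RingQuot (BraidRel p M)

/-- The inclusion of the `α`-th copy in the braided tensor product. -/
def copy (M : ℕ) (α : Fin M) : Mat p →ₐ[ℂ] Braided p M :=
  (RingQuot.mkAlgHom ℂ (BraidRel p M)).comp (incl p M α)

/-- The new generators; the first copy has index `0 : Fin M`: `y_{α,i} = x_{α,i}` for the first
copy and `y_{α,i} = ∑ⱼ x_{α,j} φ₁(L⁺^j_i)` for the others, where `φ₁` is `φ` with values in the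
first copy. -/
def y (M : ℕ) [NeZero M] (α : Fin M) (i : Fin 3) : Braided p M :=
  if α = 0 then copy p M 0 (x p i)
  else ∑ j, copy p M α (x p j) * copy p M 0 (phi p (Lplus p j i))

end FuzzySphere

end

/-!
The generators `x_i` of the fuzzy sphere span a copy of the vector representation `ρ` of
`H = U_q so(3)` under the adjoint action (`act_x`), so in a braided product `x_{β,i} a_α` only
involves the matrix `L⁺ = ℛ^(1) ρ(ℛ^(2))`:
`x_{β,i} a = ∑ⱼ (S(L^j_i) ▷ a) x_{β,j}` for `a` in an earlier copy (`copy_x_mul_copy`).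
Everything then follows from four properties of `L⁺`, an upper triangular matrix over the Borel
subalgebra generated by `q^(±H/2)` and `E^+`, whose entries are computed in `rid_lTensor_univR`.

* `Δ(L^j_i) = ∑ₖ L^j_k ⊗ L^k_i`, used in the form `φ(L^j_i) a = ∑ₖ (L^j_k ▷ a) φ(L^k_i)`
  (`phi_lU_mul`), and `S(L) L = 1` (`sum_antipode_lU_mul_lU`). Together they show that multiplying
  by `φ₁(L⁺)` undoes the braiding: `y_{α,i} = ∑ⱼ x_{α,j} φ₁(L^j_i)` commutes with the first copy
  (`y_mul_copy`).
* Consequently `y_{α,i} y_{β,j} = ∑ x_{α,k} x_{β,l} φ₁(L^l_j L^k_i)` (`y_mul_y`). Because `ε` and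
  `g` are invariant tensors, `ε^{ij}_m L^l_j L^k_i = ε^{kl}_n L^n_m` and
  `g^{ij} L^l_j L^k_i = g^{kl}` (`IsBorel.sum_eps`, `IsBorel.sum_metric`), so the relations of
  `x_α` are inherited by `y_α`.
* The `RLL` relations (`IsBorel.rMat_lMat_lMat`) let the braid matrix be carried from the `y`'s to
  the `x`'s, where it inverts the cross relations (`sum_rMat_copy_x`); this gives the exchange
  relations of `y_α` and `y_β`.

The identities for `L⁺` are verified entry by entry, after every word in the Borel subalgebra has
been brought into normal order. The relations of the `x_i` themselves follow from the formulas
`phi_E_mul_phi_F` and `phi_F_mul_phi_E`, which express `φ(E^±) φ(E^∓)` through `φ(q^(H/2))`.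
-/

noncomputable section

namespace FuzzySphere

/-! ### Matrices over the Borel subalgebra -/

lemma forall_fin_three {P : Fin 3 → Prop} : (∀ a, P a) ↔ P 0 ∧ P 1 ∧ P 2 := by
  simp [Fin.forall_fin_succ]

section Borel

variable {B : Type} [Ring B] [Algebra ℂ B]

/-- The relations of the positive Borel subalgebra of `U_q so(3)`, for elements `K`, `Ki`, `X` that
play the roles of `q^(H/2)`, `q^(-H/2)` and a multiple of `E^+`. Here `s = q^(1/2)`. -/
structure IsBorel (s : ℂ) (K Ki X : B) : Prop where
  ne_zero : s ≠ 0
  sq_add_one : s ^ 2 + 1 ≠ 0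
  K_Ki : K * Ki = 1
  Ki_K : Ki * K = 1
  K_X : K * X = s ^ 2 • (X * K)

/-- The upper triangular matrix `L⁺` of the vector representation, written in the generators of the
Borel subalgebra, with `X = (q - 1) [2]_q^(1/2) E^+` so that no square roots occur. -/
def lMat (s : ℂ) (K Ki X : B) : Fin 3 → Fin 3 → B
  | 0, 0 => Ki
  | 0, 1 => Ki * X
  | 0, 2 => (s / (s ^ 2 + 1)) • (Ki * (X * X))
  | 1, 0 => 0
  | 1, 1 => 1
  | 1, 2 => s⁻¹ • X
  | 2, 0 => 0
  | 2, 1 => 0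
  | 2, 2 => K

/-- The antipode applied to the entries of `lMat`; this is a left inverse of `lMat`
(`IsBorel.lMatInv_mul_lMat`). -/
def lMatInv (s : ℂ) (K Ki X : B) : Fin 3 → Fin 3 → B
  | 0, 0 => K
  | 0, 1 => -X
  | 0, 2 => (s⁻¹ / (s ^ 2 + 1)) • (X * (X * Ki))
  | 1, 0 => 0
  | 1, 1 => 1
  | 1, 2 => -(s⁻¹ • (X * Ki))
  | 2, 0 => 0
  | 2, 1 => 0
  | 2, 2 => Ki

/-- The vector representation of the entries of `lMat`: `rMat s h j k i` is `ρ^k_i(L⁺^h_j)`. -/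
def rMat (s : ℂ) : Fin 3 → Fin 3 → Matrix (Fin 3) (Fin 3) ℂ
  | 0, 0 => !![s ^ 2, 0, 0; 0, 1, 0; 0, 0, (s ^ 2)⁻¹]
  | 0, 1 => !![0, 0, 0; (s ^ 4 - 1) / s ^ 2, 0, 0; 0, (s ^ 4 - 1) / s ^ 3, 0]
  | 0, 2 => !![0, 0, 0; 0, 0, 0; (s ^ 4 - 1) * (s ^ 2 - 1) / s ^ 4, 0, 0]
  | 1, 0 => 0
  | 1, 1 => 1
  | 1, 2 => !![0, 0, 0; (s ^ 4 - 1) / s ^ 3, 0, 0; 0, (s ^ 4 - 1) / s ^ 2, 0]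
  | 2, 0 => 0
  | 2, 1 => 0
  | 2, 2 => !![(s ^ 2)⁻¹, 0, 0; 0, 1, 0; 0, 0, s ^ 2]

namespace IsBorel

variable {s : ℂ} {K Ki X : B} (hB : IsBorel s K Ki X)
include hB

lemma K_X_assoc (z : B) : K * (X * z) = s ^ 2 • (X * (K * z)) := by
  rw [← mul_assoc, hB.K_X, smul_mul_assoc, mul_assoc]

lemma Ki_K_assoc (z : B) : Ki * (K * z) = z := by
  rw [← mul_assoc, hB.Ki_K, one_mul]

lemma Ki_X : Ki * X = (s ^ 2)⁻¹ • (X * Ki) := by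
  have h := congrArg (fun t => Ki * (t * Ki)) hB.K_X
  simp only [mul_assoc, smul_mul_assoc, mul_smul_comm, hB.K_Ki, hB.Ki_K_assoc, mul_one] at h
  rw [h, smul_smul, inv_mul_cancel₀ (pow_ne_zero 2 hB.ne_zero), one_smul]

lemma Ki_X_assoc (z : B) : Ki * (X * z) = (s ^ 2)⁻¹ • (X * (Ki * z)) := by
  rw [← mul_assoc, hB.Ki_X, smul_mul_assoc, mul_assoc]

lemma lMatInv_mul_lMat (a b : Fin 3) :
    ∑ c, lMatInv s K Ki X a c * lMat s K Ki X c b = if a = b then 1 else 0 := by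
  have hs := hB.ne_zero
  have hs' := hB.sq_add_one
  revert a b
  simp only [forall_fin_three, Fin.sum_univ_three, lMat, lMatInv, mul_assoc, hB.K_Ki, hB.Ki_K,
    hB.Ki_X, hB.Ki_X_assoc, hB.K_X_assoc, mul_smul_comm, smul_mul_assoc,
    smul_smul, neg_mul, mul_zero, zero_mul, mul_one, one_mul, Fin.reduceEq, if_true, if_false,
    smul_zero, zero_add, add_zero, add_neg_cancel, true_and, and_true]
  refine ⟨?_, ?_⟩ <;> match_scalars <;> field_simp <;> ring

/-- The `RLL` relations: `∑ ρ^k_i(L^h_j) L^b_k L^a_h = ∑ ρ^b_k(L^a_h) L^h_j L^k_i`, the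
Yang-Baxter equation for `ℛ` with the vector representation on the last two factors. -/
lemma rMat_lMat_lMat (a b i j : Fin 3) :
    ∑ h, ∑ k, rMat s h j k i • (lMat s K Ki X b k * lMat s K Ki X a h)
      = ∑ h, ∑ k, rMat s a h b k • (lMat s K Ki X h j * lMat s K Ki X k i) := by
  have hs := hB.ne_zero
  have hs' := hB.sq_add_one
  revert a b i j
  simp only [forall_fin_three, Fin.sum_univ_three, lMat, rMat, Matrix.of_apply,
    Matrix.cons_val, Matrix.cons_val_zero, Matrix.cons_val_one, Matrix.zero_apply,
    Matrix.one_apply, Fin.reduceEq, if_true, if_false, zero_smul, smul_zero, zero_mul, mul_zero,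
    add_zero, zero_add, true_and, and_true, one_smul, mul_one, one_mul]
  simp only [mul_assoc, hB.K_Ki, hB.Ki_K, hB.K_X, hB.Ki_X, hB.K_X_assoc, hB.Ki_X_assoc,
    mul_smul_comm, smul_mul_assoc, smul_smul, true_and, mul_one]
  repeat' apply And.intro
  all_goals (match_scalars <;> field_simp <;> ring)

end IsBorel

/-- The tensor `ε` intertwines the vector representation with its tensor square. -/
lemma IsBorel.sum_eps {p : Params} {K Ki X : B} (hB : IsBorel (p.s : ℂ) K Ki X) (k l m : Fin 3) :
    ∑ i, ∑ j, (eps p i j m : ℂ) • (lMat (p.s : ℂ) K Ki X l j * lMat (p.s : ℂ) K Ki X k i)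
      = ∑ n, (eps p k l n : ℂ) • lMat (p.s : ℂ) K Ki X n m := by
  have hs := hB.ne_zero
  have hs' := hB.sq_add_one
  revert k l m
  simp only [forall_fin_three, Fin.sum_univ_three, lMat, eps, Complex.ofReal_zero,
    Complex.ofReal_one, Complex.ofReal_neg, Complex.ofReal_sub, Complex.ofReal_inv,
    zero_smul, smul_zero, zero_mul, mul_zero, add_zero, zero_add, true_and, and_true, one_smul,
    mul_one, one_mul]
  simp only [mul_assoc, hB.K_Ki, hB.Ki_K, hB.Ki_X, hB.K_X_assoc, hB.Ki_X_assoc,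
    mul_smul_comm, smul_mul_assoc, smul_smul, true_and, mul_one]
  repeat' apply And.intro
  all_goals (match_scalars <;> field_simp <;> ring)

/-- The metric `g` is an invariant tensor. -/
lemma IsBorel.sum_metric {p : Params} {K Ki X : B} (hB : IsBorel (p.s : ℂ) K Ki X) (k l : Fin 3) :
    ∑ i, ∑ j, (metric p i j : ℂ) • (lMat (p.s : ℂ) K Ki X l j * lMat (p.s : ℂ) K Ki X k i)
      = (metric p k l : ℂ) • 1 := by
  have hs := hB.ne_zero
  have hs' := hB.sq_add_one
  revert k l
  simp only [forall_fin_three, Fin.sum_univ_three, lMat, metric, Complex.ofReal_zero,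
    Complex.ofReal_one, Complex.ofReal_neg, Complex.ofReal_inv,
    zero_smul, smul_zero, zero_mul, mul_zero, add_zero, zero_add, and_true, one_smul,
    mul_one, one_mul]
  simp only [mul_assoc, hB.K_Ki, hB.Ki_K, hB.Ki_X, hB.Ki_X_assoc,
    mul_smul_comm, smul_mul_assoc, smul_smul, and_true]
  repeat' apply And.intro
  all_goals (match_scalars; field_simp; ring)

lemma lMat_map {B' : Type} [Ring B'] [Algebra ℂ B'] (f : B →ₐ[ℂ] B') (s : ℂ) (K Ki X : B)
    (i j : Fin 3) : f (lMat s K Ki X i j) = lMat s (f K) (f Ki) (f X) i j := by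
  revert i j
  simp [forall_fin_three, lMat, -Complex.coe_smul]

lemma IsBorel.map {B' : Type} [Ring B'] [Algebra ℂ B'] (f : B →ₐ[ℂ] B') {s : ℂ} {K Ki X : B}
    (hB : IsBorel s K Ki X) : IsBorel s (f K) (f Ki) (f X) where
  ne_zero := hB.ne_zero
  sq_add_one := hB.sq_add_one
  K_Ki := by rw [← map_mul, hB.K_Ki, map_one]
  Ki_K := by rw [← map_mul, hB.Ki_K, map_one]
  K_X := by rw [← map_mul, hB.K_X, map_smul, map_mul]

end Borel

variable (p : Params)

/-! ### The R-matrix in the vector representation -/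

/-- To prove a property of all elements of `U_q so(3)`, it suffices to treat scalars and the
generators and to check stability under sums and products. -/
lemma U_induction {P : U p → Prop} (g : U p) (hc : ∀ c : ℂ, P (algebraMap ℂ (U p) c))
    (hg : ∀ x : Gen, P (gen p x)) (hm : ∀ a b, P a → P b → P (a * b))
    (ha : ∀ a b, P a → P b → P (a + b)) : P g := by
  obtain ⟨z, rfl⟩ := RingQuot.mkAlgHom_surjective ℂ (URel p) g
  induction z using FreeAlgebra.induction with
  | grade0 r =>
    rw [AlgHom.commutes]
    exact hc r
  | grade1 x => exact hg x
  | mul a b h₁ h₂ => rw [map_mul]; exact hm _ _ h₁ h₂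
  | add a b h₁ h₂ => rw [map_add]; exact ha _ _ h₁ h₂

/-- The multiple `(q - 1) [2]_q^(1/2) E^+` of the raising operator. -/
def raise : U p := (((p.q - 1) * p.r : ℝ) : ℂ) • gen p .E

lemma isBorel : IsBorel (p.s : ℂ) (gen p .K) (gen p .Ki) (raise p) where
  ne_zero := s_ne p
  sq_add_one := by
    have : p.s ^ 2 + 1 ≠ 0 := by positivity
    exact_mod_cast this
  K_Ki := gen_K_Ki p
  Ki_K := gen_Ki_K p
  K_X := by
    rw [raise, mul_smul_comm, gen_K_E, smul_mul_assoc, smul_comm, q_eq, sq]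

/-- The matrix `L⁺` of the vector representation, with explicit entries. -/
abbrev lU : Fin 3 → Fin 3 → U p := lMat (p.s : ℂ) (gen p .K) (gen p .Ki) (raise p)

lemma vecRep_K : vecRep p (gen p .K)
    = Matrix.diagonal fun i : Fin 3 => (p.q : ℂ) ^ ((i : ℤ) - 1) := by
  rw [vecRep, liftU_gen]
  ext i j
  fin_cases i <;> fin_cases j <;> simp

lemma vecRep_Ki : vecRep p (gen p .Ki) = !![(p.q : ℂ), 0, 0; 0, 1, 0; 0, 0, (p.q : ℂ)⁻¹] := by
  rw [vecRep, liftU_gen]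

lemma vecRep_E : vecRep p (gen p .E)
    = !![0, 0, 0; ((p.r * p.s⁻¹ : ℝ) : ℂ), 0, 0; 0, (p.r : ℂ), 0] := by
  rw [vecRep, liftU_gen]

lemma vecRep_F : vecRep p (gen p .F)
    = !![0, (p.r : ℂ), 0; 0, 0, ((p.r * p.s : ℝ) : ℂ); 0, 0, 0] := by
  rw [vecRep, liftU_gen]

/-- The elements `wtProj p d m` act on the vector representation, whose weights are `-1, 0, 1`, as
the weight projections. -/
lemma vecRep_wtProj {d : ℕ} (hd : 1 ≤ d) {m : ℤ} (hm : m ∈ Finset.Icc (-(d : ℤ)) d) :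
    vecRep p (wtProj p d m) = Matrix.diagonal fun i : Fin 3 => if m = (i : ℤ) - 1 then 1 else 0 := by
  have hinj : Function.Injective (fun j : ℤ => (p.q : ℂ) ^ j) := by
    intro a b h
    have h' : ((p.q ^ a : ℝ) : ℂ) = ((p.q ^ b : ℝ) : ℂ) := by
      rw [Complex.ofReal_zpow, Complex.ofReal_zpow]
      exact h
    exact zpow_right_injective₀ p.q_pos p.q_ne_one (Complex.ofReal_injective h')
  rw [wtProj, ← Polynomial.aeval_algHom_apply, vecRep_K]
  have hdiag (v : Fin 3 → ℂ) : Matrix.diagonal v = Matrix.diagonalAlgHom ℂ v := rfl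
  rw [hdiag, Polynomial.aeval_algHom_apply, Polynomial.aeval_pi_apply, ← hdiag]
  congr 1
  ext i
  rw [Polynomial.coe_aeval_eq_eval]
  have hi : (i : ℤ) - 1 ∈ Finset.Icc (-(d : ℤ)) d := by
    rw [Finset.mem_Icc]; omega
  split_ifs with h
  · subst h
    exact Lagrange.eval_basis_self (v := fun j : ℤ => (p.q : ℂ) ^ j) hinj.injOn hi
  · exact Lagrange.eval_basis_of_ne (v := fun j : ℤ => (p.q : ℂ) ^ j) h hi

lemma vecRep_F_Ki : vecRep p (gen p .F * gen p .Ki)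
    = !![0, (p.r : ℂ), 0; 0, 0, p.r * (p.s : ℂ)⁻¹; 0, 0, 0] := by
  have := s_ne p
  rw [map_mul, vecRep_F, vecRep_Ki, q_eq]
  ext i j
  fin_cases i <;> fin_cases j <;> simp [Matrix.mul_apply, Fin.sum_univ_three]
  field_simp

/-- Powers of `ρ(E^- q^(-H/2))` vanish from the third on. -/
lemma vecRep_F_Ki_pow (n : ℕ) : vecRep p (gen p .F * gen p .Ki) ^ (n + 3) = 0 := by
  have : vecRep p (gen p .F * gen p .Ki) ^ 3 = 0 := by
    rw [vecRep_F_Ki, pow_succ, pow_two]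
    ext i j
    fin_cases i <;> fin_cases j <;> simp [Matrix.mul_apply, Fin.sum_univ_three]
  rw [pow_add, this, mul_zero]

/-- Applying the vector representation to the second tensor factor of the universal R-matrix
gives the matrix `L⁺`; the truncation parameter `d ≥ 1` of the R-matrix does not matter. -/
lemma rid_lTensor_univR {d : ℕ} (hd : 1 ≤ d) (i j : Fin 3) :
    TensorProduct.rid ℂ (U p) ((rho p i j).lTensor (U p) (univR p d)) = lU p i j := by
  have hrho (m : ℤ) (hm : m ∈ Finset.Icc (-(d : ℤ)) d) (n : ℕ) :
      rho p i j (wtProj p d m * (gen p .F * gen p .Ki) ^ n)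
        = if m = (i : ℤ) - 1 then (vecRep p (gen p .F * gen p .Ki) ^ n) i j else 0 := by
    rw [rho, LinearMap.comp_apply, AlgHom.toLinearMap_apply, map_mul, map_pow,
      vecRep_wtProj p hd hm, Matrix.entryLinearMap_apply, Matrix.diagonal_mul, ite_mul, one_mul,
      zero_mul]
  have hi : (i : ℤ) - 1 ∈ Finset.Icc (-(d : ℤ)) d := by
    rw [Finset.mem_Icc]; omega
  obtain ⟨e, he⟩ : ∃ e, 2 * d + 1 = e + 3 := ⟨2 * d - 2, by omega⟩
  have hsum : TensorProduct.rid ℂ (U p) ((rho p i j).lTensor (U p) (univR p d))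
      = ∑ n ∈ Finset.range 3,
        ((((p.q - 1) ^ n * p.q ^ ((n * (n - 1) : ℝ) / 4) / qfact p.q n : ℝ) : ℂ)
          * (vecRep p (gen p .F * gen p .Ki) ^ n) i j) •
          (((Kunit p ^ ((i : ℤ) - 1) : (U p)ˣ) : U p) * gen p .E ^ n) := by
    have hinner (n : ℕ) (c : ℂ) : ∑ m ∈ Finset.Icc (-(d : ℤ)) d,
        c • rho p i j (wtProj p d m * (gen p .F * gen p .Ki) ^ n) •
          (((Kunit p ^ m : (U p)ˣ) : U p) * gen p .E ^ n)
        = (c * (vecRep p (gen p .F * gen p .Ki) ^ n) i j) •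
          (((Kunit p ^ ((i : ℤ) - 1) : (U p)ˣ) : U p) * gen p .E ^ n) := by
      rw [Finset.sum_congr rfl fun m hm => by rw [hrho m hm n, ite_smul, zero_smul, smul_ite,
        smul_zero], Finset.sum_ite_eq', if_pos hi, smul_smul]
    simp only [univR, map_sum, map_smul, LinearMap.lTensor_tmul, TensorProduct.rid_tmul, hinner]
    -- The terms with `n ≥ 3` vanish, as `ρ(E^- q^(-H/2))` is nilpotent of order 3.
    rw [he, add_comm, Finset.sum_range_add, add_eq_left]
    refine Finset.sum_eq_zero fun n _ => ?_
    rw [add_comm, vecRep_F_Ki_pow, Matrix.zero_apply, mul_zero, zero_smul]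
  have hs := s_ne p
  have hs' := (isBorel p).sq_add_one
  have hr : (p.r : ℂ) * p.r = p.s + (p.s : ℂ)⁻¹ := by exact_mod_cast r_sq p
  have h1 : qnum p.q 1 = 1 := by
    rw [qnum, div_self]
    have := s_sub_ne p
    rwa [Params.s, ← Real.rpow_neg p.q_pos.le] at this
  have hF2 : vecRep p (gen p .F * gen p .Ki) ^ 2
      = !![0, 0, 1 + ((p.s : ℂ) ^ 2)⁻¹; 0, 0, 0; 0, 0, 0] := by
    rw [vecRep_F_Ki, pow_two]
    ext i j
    fin_cases i <;> fin_cases j <;> simp [Matrix.mul_apply, Fin.sum_univ_three]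
    rw [← mul_assoc, hr]
    field_simp
  have hc0 : (p.q - 1) ^ 0 * p.q ^ (((0 : ℕ) * ((0 : ℕ) - 1) : ℝ) / 4) / qfact p.q 0 = 1 := by
    simp [qfact]
  have hc1 : (p.q - 1) ^ 1 * p.q ^ (((1 : ℕ) * ((1 : ℕ) - 1) : ℝ) / 4) / qfact p.q 1
      = p.q - 1 := by
    simp [qfact, h1]
  have hc2 : (p.q - 1) ^ 2 * p.q ^ (((2 : ℕ) * ((2 : ℕ) - 1) : ℝ) / 4) / qfact p.q 2
      = (p.q - 1) ^ 2 * p.s / (p.s + p.s⁻¹) := by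
    rw [← qnum_two, Params.s]
    norm_num [qfact, h1, Finset.prod_range_succ]
  rw [hsum, Finset.sum_range_succ, Finset.sum_range_succ, Finset.sum_range_succ,
    Finset.sum_range_zero, zero_add, hc0, hc1, hc2, hF2, pow_zero, pow_one, pow_one, vecRep_F_Ki]
  have hK : ((Kunit p ^ (-1 : ℤ) : (U p)ˣ) : U p) = gen p .Ki := by
    rw [zpow_neg_one]; rfl
  have hK' : ((Kunit p : (U p)ˣ) : U p) = gen p .K := rfl
  clear hrho hi hsum hc0 hc1 hc2
  revert i j
  simp [forall_fin_three, lMat, raise, hK, hK', -Complex.coe_smul, -zpow_neg]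
  constructor
  · rw [pow_two (gen p .E)]
    match_scalars
    have h : (p.s : ℂ) + (p.s : ℂ)⁻¹ ≠ 0 := by
      intro h
      apply hs'
      field_simp at h
      simpa using h
    have h2 : (p.r : ℂ) ^ 2 = p.s + (p.s : ℂ)⁻¹ := by rw [sq, hr]
    field_simp
    rw [h2]
    field_simp
  · match_scalars
    ring

lemma Lplus_eq (i j : Fin 3) : Lplus p i j = lU p i j := rid_lTensor_univR p le_rfl i j

lemma vecRep_raise : vecRep p (raise p) = !![0, 0, 0; ((p.s : ℂ) ^ 4 - 1) / p.s ^ 2, 0, 0;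
    0, ((p.s : ℂ) ^ 4 - 1) / p.s, 0] := by
  have hs := s_ne p
  have h2 : (p.r : ℂ) ^ 2 = p.s + (p.s : ℂ)⁻¹ := by exact_mod_cast (sq p.r).trans (r_sq p)
  rw [raise, map_smul, vecRep_E]
  ext i j
  fin_cases i <;> fin_cases j <;> simp [q_eq, -Complex.coe_smul]
  all_goals
    field_simp
    rw [h2]
    field_simp
    ring

/-- `rMat` is the vector representation applied to `L⁺`, hence the R-matrix in `ρ ⊗ ρ`. -/
lemma rho_lU (h j k i : Fin 3) : rho p k i (lU p h j) = rMat (p.s : ℂ) h j k i := by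
  have hs := s_ne p
  have hs' := (isBorel p).sq_add_one
  rw [rho, LinearMap.comp_apply, AlgHom.toLinearMap_apply, lMat_map, vecRep_raise, vecRep_K,
    vecRep_Ki, Matrix.entryLinearMap_apply]
  revert h j k i
  simp [forall_fin_three, lMat, rMat, q_eq, -Complex.coe_smul]
  refine ⟨⟨⟨?_, ?_⟩, ?_, ?_⟩, ⟨?_, ?_⟩, ?_, ?_⟩
  all_goals
    field_simp
    try ring

/-- If the second map factors through a copy of the vector representation, evaluating the
universal R-matrix only involves the matrix `L⁺`. -/
lemma map_rho_univR {B : Type} [Ring B] [Algebra ℂ B] {d : ℕ} (hd : 1 ≤ d) (f g : U p →ₗ[ℂ] B)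
    (v : Fin 3 → B) (i : Fin 3) (hg : ∀ u, g u = ∑ j, rho p j i u • v j) :
    LinearMap.mul' ℂ B (TensorProduct.map f g (univR p d)) = ∑ j, f (lU p j i) * v j := by
  have h (t : U p ⊗[ℂ] U p) : LinearMap.mul' ℂ B (TensorProduct.map f g t)
      = ∑ j, f (TensorProduct.rid ℂ (U p) ((rho p j i).lTensor (U p) t)) * v j := by
    induction t using TensorProduct.induction_on with
    | zero => simp
    | tmul a b =>
      simp only [TensorProduct.map_tmul, LinearMap.mul'_apply, hg, LinearMap.lTensor_tmul,
        TensorProduct.rid_tmul, map_smul, Finset.mul_sum, smul_mul_assoc, mul_smul_comm]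
    | add a b ha hb => simp only [map_add, ha, hb, add_mul, Finset.sum_add_distrib]
  simp only [h, rid_lTensor_univR p hd]

lemma Rhat_eq (h k i j : Fin 3) : Rhat p h k i j = rMat (p.s : ℂ) h j k i := by
  have hR (t : U p ⊗[ℂ] U p) : LinearMap.mul' ℂ ℂ (TensorProduct.map (rho p k i) (rho p h j) t)
      = rho p k i (TensorProduct.rid ℂ (U p) ((rho p h j).lTensor (U p) t)) := by
    induction t using TensorProduct.induction_on with
    | zero => simp
    | tmul a b => simp [mul_comm]
    | add a b ha hb => simp only [map_add, ha, hb]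
  rw [Rhat, hR, rid_lTensor_univR p le_rfl, rho_lU]

/-! ### Antipode -/

lemma antipode_mul (a b : U p) : antipode p (a * b) = antipode p b * antipode p a := by
  simp [antipode]

lemma antipode_one : antipode p 1 = 1 := by
  simp [antipode]

lemma antipode_K : antipode p (gen p .K) = gen p .Ki := by
  simp [antipode, antipodeHom, liftU_gen]

lemma antipode_Ki : antipode p (gen p .Ki) = gen p .K := by
  simp [antipode, antipodeHom, liftU_gen]

lemma antipode_E : antipode p (gen p .E) = -(gen p .E * gen p .Ki) := by
  simp [antipode, antipodeHom, liftU_gen]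

lemma antipode_raise : antipode p (raise p) = -(raise p * gen p .Ki) := by
  rw [raise, map_smul, antipode_E, smul_neg, smul_mul_assoc]

lemma antipode_lU (i j : Fin 3) :
    antipode p (lU p i j) = lMatInv (p.s : ℂ) (gen p .K) (gen p .Ki) (raise p) i j := by
  have hB := isBorel p
  have hs := s_ne p
  have hs' := hB.sq_add_one
  revert i j
  simp [forall_fin_three, lMat, lMatInv, antipode_mul, antipode_one, antipode_K, antipode_Ki,
    antipode_raise, mul_assoc, hB.Ki_K, hB.Ki_X, hB.K_X_assoc, hB.K_Ki,
    -Complex.coe_smul]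
  constructor <;> match_scalars <;> field_simp

/-! ### The adjoint action on the fuzzy sphere -/

lemma phi_K : phi p (gen p .K) = phiK p := by rw [phi, liftU_gen]

lemma phi_E : phi p (gen p .E) = phiE p := by rw [phi, liftU_gen]

lemma phi_F : phi p (gen p .F) = phiF p := by rw [phi, liftU_gen]

lemma act_K (a : Mat p) : act p (gen p .K) a = phi p (gen p .K) * a * phi p (gen p .Ki) := by
  simp [act, comul, antipodeHom, liftU_gen, actL, actR, mul_assoc]

lemma act_Ki (a : Mat p) : act p (gen p .Ki) a = phi p (gen p .Ki) * a * phi p (gen p .K) := by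
  simp [act, comul, antipodeHom, liftU_gen, actL, actR, mul_assoc]

lemma act_E (a : Mat p) : act p (gen p .E) a
    = (phi p (gen p .E) * a - a * phi p (gen p .E)) * phi p (gen p .Ki) := by
  simp [act, comul, antipodeHom, liftU_gen, actL, actR, mul_assoc, sub_mul, ← sub_eq_add_neg]

lemma act_F (a : Mat p) : act p (gen p .F) a
    = (phi p (gen p .F) * a - a * phi p (gen p .F)) * phi p (gen p .Ki) := by
  simp [act, comul, antipodeHom, liftU_gen, actL, actR, mul_assoc, sub_mul, ← sub_eq_add_neg]

lemma act_raise (a : Mat p) : act p (raise p) a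
    = (phi p (raise p) * a - a * phi p (raise p)) * phi p (gen p .Ki) := by
  rw [raise, map_smul, LinearMap.smul_apply, act_E, map_smul, smul_mul_assoc, mul_smul_comm,
    ← smul_sub, smul_mul_assoc]

/-- The identity `φ(g) a = (g_(1) ▷ a) φ(g_(2))` for the entries of `L⁺`, whose coproduct is
`Δ(L^j_i) = ∑ₖ L^j_k ⊗ L^k_i`. -/
lemma phi_lU_mul (a : Mat p) (j i : Fin 3) :
    phi p (lU p j i) * a = ∑ k, act p (lU p j k) a * phi p (lU p k i) := by
  have hB := (isBorel p).map (phi p)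
  have hs := s_ne p
  have hs' := hB.sq_add_one
  simp only [lMat_map]
  revert j i
  simp [forall_fin_three, lMat, Fin.sum_univ_three, act_K, act_Ki, act_raise, mul_assoc,
    hB.Ki_K, hB.K_Ki, hB.Ki_X, hB.Ki_X_assoc, hB.K_X_assoc,
    -Complex.coe_smul]
  simp only [sub_mul, mul_sub, smul_sub, mul_assoc, mul_smul_comm, smul_mul_assoc, hB.Ki_X_assoc,
    hB.Ki_K, mul_one]
  refine ⟨⟨?_, ?_⟩, ?_⟩ <;> match_scalars <;> field_simp <;> ring

/-! ### The generators of the fuzzy sphere -/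

/-- The normalization `R / √([N]_q [N+2]_q)` of the generators `x_i`. -/
def Params.c : ℝ := p.R / √(qnum p.q p.N * qnum p.q (p.N + 2))

/-- `[2]_{q^(N+1)}`. -/
def Params.T : ℝ := qnum (p.q ^ (p.N + 1)) 2

/-- `q^(1/2) - q^(-1/2)`. -/
def Params.d : ℝ := p.s - p.s⁻¹

lemma sq_sub_one_ne : (p.s : ℂ) ^ 2 - 1 ≠ 0 := by
  have h := s_sub_ne p
  have hs := (s_pos p).ne'
  have : p.s ^ 2 - 1 ≠ 0 := by
    intro h'
    apply h
    field_simp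
    linarith
  exact_mod_cast this

lemma d_inv : (p.d : ℂ)⁻¹ = p.s / ((p.s : ℂ) ^ 2 - 1) := by
  have hs := s_ne p
  have hd := sq_sub_one_ne p
  rw [Params.d]
  push_cast
  rw [show (p.s : ℂ) - (p.s : ℂ)⁻¹ = ((p.s : ℂ) ^ 2 - 1) / p.s by field_simp, inv_div]

lemma Lam_eq : p.Lam = p.c * p.T := by
  rw [Params.Lam, Params.c, Params.T]
  ring

lemma T_eq : p.T = p.q ^ ((p.N : ℝ) / 2) * p.s + (p.q ^ ((p.N : ℝ) / 2))⁻¹ * p.s⁻¹ := by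
  have h : p.q ^ (p.N + 1) ≠ 1 := by
    intro h
    exact p.q_ne_one ((pow_eq_one_iff_of_nonneg p.q_pos.le (by omega)).1 h)
  have h2 := qnum_two ⟨p.q ^ (p.N + 1), p.N, p.R, pow_pos p.q_pos _, h, p.N_pos, p.R_pos⟩
  have hs : (p.q ^ (p.N + 1)) ^ (1 / 2 : ℝ) = p.q ^ ((p.N : ℝ) / 2) * p.s := by
    rw [Params.s, ← Real.rpow_natCast, ← Real.rpow_mul p.q_pos.le, ← Real.rpow_add p.q_pos]
    congr 1
    push_cast
    ring
  simp only [Params.s] at h2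
  rw [Params.T, h2, hs, mul_inv]

lemma qN_mul_qN2 : qnum p.q p.N * qnum p.q (p.N + 2)
    = (p.T ^ 2 - (p.s + p.s⁻¹) ^ 2) * (p.d⁻¹) ^ 2 := by
  have hs := (s_pos p).ne'
  have hB : 0 < p.q ^ ((p.N : ℝ) / 2) := Real.rpow_pos_of_pos p.q_pos _
  have e1 : p.q ^ (((p.N : ℝ) + 2) / 2) = p.q ^ ((p.N : ℝ) / 2) * (p.s * p.s) := by
    rw [Params.s, ← Real.rpow_add p.q_pos, ← Real.rpow_add p.q_pos]; congr 1; ring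
  rw [qnum_eq, qnum_eq, T_eq, Params.d, Real.rpow_neg p.q_pos.le, Real.rpow_neg p.q_pos.le, e1]
  generalize (p.s - p.s⁻¹)⁻¹ = d
  field_simp
  ring

/-- The normalization of the `x_i` fixes the radius of the sphere. -/
lemma c_sq : p.c ^ 2 * ((p.T ^ 2 - (p.s + p.s⁻¹) ^ 2) * (p.d⁻¹) ^ 2) = p.R ^ 2 := by
  have h := mul_pos (qN_pos p) (qN2_pos p)
  rw [← qN_mul_qN2, Params.c, div_pow, Real.sq_sqrt h.le, div_mul_cancel₀ _ h.ne']

lemma x_two : x p 2 = ((p.c * (p.s * p.r) : ℝ) : ℂ) • phi p (gen p .E) := by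
  have h : p.R * √(p.q * qnum p.q 2 / (qnum p.q p.N * qnum p.q (p.N + 2)))
      = p.c * (p.s * p.r) := by
    rw [Real.sqrt_div (mul_nonneg p.q_pos.le (q2_pos p).le), Real.sqrt_mul p.q_pos.le,
      ← s_sq, Real.sqrt_mul_self (s_pos p).le, s_sq, Params.c, Params.r]
    ring
  rw [phi_E, phiE_eq]
  ext a b
  simp only [x, Matrix.smul_apply, Matrix.of_apply, smul_eq_mul, mul_ite, mul_zero, h,
    Complex.ofReal_mul]

lemma x_zero : x p 0 = ((-(p.c * (p.r * p.s⁻¹)) : ℝ) : ℂ) • phi p (gen p .F) := by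
  have h : p.R * √(qnum p.q 2 / (p.q * (qnum p.q p.N * qnum p.q (p.N + 2))))
      = p.c * (p.r * p.s⁻¹) := by
    rw [Real.sqrt_div (q2_pos p).le, Real.sqrt_mul p.q_pos.le,
      ← s_sq, Real.sqrt_mul_self (s_pos p).le, s_sq, Params.c, Params.r]
    ring
  rw [phi_F, phiF_eq]
  ext a b
  simp only [x, Matrix.smul_apply, Matrix.of_apply, smul_eq_mul, mul_ite, mul_zero, h,
    Complex.ofReal_mul, Complex.ofReal_neg]

lemma x_one : x p 1 = ((p.c * p.d⁻¹ : ℝ) : ℂ) •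
    ((p.T : ℂ) • 1 - ((p.s + p.s⁻¹ : ℝ) : ℂ) • phi p (gen p .K)) := by
  rw [phi_K, phiK_eq]
  ext a b
  rcases eq_or_ne a b with rfl | hab
  · simp only [x, Matrix.smul_apply, Matrix.sub_apply, Matrix.one_apply_eq,
      Matrix.diagonal_apply_eq, smul_eq_mul, Params.c, Params.T, Params.d, qnum_two]
    push_cast
    rw [← div_div]
    ring
  · simp [x, hab]

/-- The value of the Casimir element in the representation `φ`, solved for `φ(E^+) φ(E^-)`. -/
lemma phi_E_mul_phi_F : phi p (gen p .E) * phi p (gen p .F)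
    = ((p.d⁻¹ ^ 2 : ℝ) : ℂ) • (((p.T * p.s⁻¹ : ℝ) : ℂ) • phi p (gen p .K)
      - ((p.s⁻¹ ^ 2 : ℝ) : ℂ) • (phi p (gen p .K) * phi p (gen p .K)) - 1) := by
  have hs := (s_pos p).ne'
  rw [phi_E, phi_F, phi_K, phiE_mul_phiF, phiK_eq, Matrix.diagonal_mul_diagonal]
  ext a b
  rcases eq_or_ne a b with rfl | hab
  · simp only [Matrix.smul_apply, Matrix.sub_apply, Matrix.one_apply_eq,
      Matrix.diagonal_apply_eq, smul_eq_mul]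
    have hA : 0 < p.q ^ ((a : ℝ) / 2) := Real.rpow_pos_of_pos p.q_pos _
    have hB : 0 < p.q ^ ((p.N : ℝ) / 2) := Real.rpow_pos_of_pos p.q_pos _
    have e1 : p.q ^ (((a : ℝ) + 1) / 2) = p.q ^ ((a : ℝ) / 2) * p.s := by
      rw [Params.s, ← Real.rpow_add p.q_pos]; congr 1; ring
    have e2 : p.q ^ (((p.N : ℝ) - a) / 2) = p.q ^ ((p.N : ℝ) / 2) / p.q ^ ((a : ℝ) / 2) := by
      rw [← Real.rpow_sub p.q_pos]; congr 1; ring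
    have e3 : p.q ^ (((p.N : ℝ) - 2 * a) / 2)
        = p.q ^ ((p.N : ℝ) / 2) / p.q ^ ((a : ℝ) / 2) / p.q ^ ((a : ℝ) / 2) := by
      rw [← Real.rpow_sub p.q_pos, ← Real.rpow_sub p.q_pos]; congr 1; ring
    have e4 : p.q ^ (((p.N : ℝ) - 2 * a - 1) / 2)
        = p.q ^ ((p.N : ℝ) / 2) / p.q ^ ((a : ℝ) / 2) / p.q ^ ((a : ℝ) / 2) / p.s := by
      rw [Params.s, ← Real.rpow_sub p.q_pos, ← Real.rpow_sub p.q_pos, ← Real.rpow_sub p.q_pos]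
      congr 1; ring
    -- With `A = q^(a/2)` and `B = q^(N/2)`, both sides are rational functions of `A`, `B`, `s`.
    norm_cast
    rw [qnum_eq, qnum_eq, T_eq, Params.d, Real.rpow_neg p.q_pos.le, Real.rpow_neg p.q_pos.le]
    push_cast
    rw [e1, e2, e3, e4]
    generalize (p.s - p.s⁻¹)⁻¹ = d
    field_simp
    ring
  · simp [hab]

lemma phi_F_mul_phi_E : phi p (gen p .F) * phi p (gen p .E)
    = ((p.d⁻¹ ^ 2 : ℝ) : ℂ) • (((p.T * p.s : ℝ) : ℂ) • phi p (gen p .K)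
      - ((p.s ^ 2 : ℝ) : ℂ) • (phi p (gen p .K) * phi p (gen p .K)) - 1) := by
  have hs := s_ne p
  have hd := sq_sub_one_ne p
  -- Follows from the formula for `φ(E^+) φ(E^-)` and the commutation relation of `E^±`.
  have h := congrArg (phi p) (gen_E_F p)
  simp only [map_sub, map_smul, map_mul, map_one] at h
  rw [phi_E_mul_phi_F, sub_eq_iff_eq_add', ← sub_eq_iff_eq_add] at h
  have h' := congrArg ((p.s : ℂ) • ·) h
  simp only [smul_smul, mul_inv_cancel₀ hs, one_smul] at h'
  have hd' := d_inv p
  rw [Params.d] at hd'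
  push_cast at hd'
  rw [← h', hd']
  push_cast
  rw [d_inv]
  match_scalars <;> field_simp <;> ring

lemma phi_K_Ki : phi p (gen p .K) * phi p (gen p .Ki) = 1 := by
  rw [← map_mul, gen_K_Ki, map_one]

lemma phi_Ki_K : phi p (gen p .Ki) * phi p (gen p .K) = 1 := by
  rw [← map_mul, gen_Ki_K, map_one]

lemma phi_K_E : phi p (gen p .K) * phi p (gen p .E)
    = (p.q : ℂ) • (phi p (gen p .E) * phi p (gen p .K)) := by
  rw [← map_mul, gen_K_E, map_smul, map_mul]

lemma phi_K_F : phi p (gen p .K) * phi p (gen p .F)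
    = (p.q : ℂ)⁻¹ • (phi p (gen p .F) * phi p (gen p .K)) := by
  rw [← map_mul, gen_K_F, map_smul, map_mul]

lemma phi_Ki_E : phi p (gen p .Ki) * phi p (gen p .E)
    = (p.q : ℂ)⁻¹ • (phi p (gen p .E) * phi p (gen p .Ki)) := by
  rw [← map_mul, gen_Ki_E, map_smul, map_mul]

lemma phi_Ki_F : phi p (gen p .Ki) * phi p (gen p .F)
    = (p.q : ℂ) • (phi p (gen p .F) * phi p (gen p .Ki)) := by
  rw [← map_mul, gen_Ki_F, map_smul, map_mul]

lemma act_gen_x (g : Gen) (i : Fin 3) :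
    act p (gen p g) (x p i) = ∑ j, rho p j i (gen p g) • x p j := by
  have hs := s_ne p
  have hd := sq_sub_one_ne p
  have hr : (p.r : ℂ) ^ 2 = p.s + (p.s : ℂ)⁻¹ := by exact_mod_cast (sq p.r).trans (r_sq p)
  have hq := q_eq p
  have hd' := d_inv p
  have hKE : phi p (gen p .K) * (phi p (gen p .E) * phi p (gen p .Ki))
      = (p.q : ℂ) • phi p (gen p .E) := by
    rw [← mul_assoc, phi_K_E, smul_mul_assoc, mul_assoc, phi_K_Ki, mul_one]
  have hKF : phi p (gen p .K) * (phi p (gen p .F) * phi p (gen p .Ki))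
      = (p.q : ℂ)⁻¹ • phi p (gen p .F) := by
    rw [← mul_assoc, phi_K_F, smul_mul_assoc, mul_assoc, phi_K_Ki, mul_one]
  rw [Fin.sum_univ_three]
  cases g
  · have hEF := congrArg (· * phi p (gen p .Ki)) (phi_E_mul_phi_F p)
    have hFE := congrArg (· * phi p (gen p .Ki)) (phi_F_mul_phi_E p)
    simp only [sub_mul, smul_mul_assoc, mul_assoc, phi_K_Ki, mul_one, one_mul] at hEF hFE
    revert i
    simp [forall_fin_three, act_E, x_zero, x_one, x_two, rho, vecRep_E,
      -Complex.coe_smul, -inv_pow, mul_sub, sub_mul, hKE, hEF, hFE, mul_assoc, phi_K_Ki, hd', hq]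
    constructor <;> match_scalars <;> field_simp <;> (try rw [hr]) <;>
      (try field_simp) <;> ring
  · have hEF := congrArg (· * phi p (gen p .Ki)) (phi_E_mul_phi_F p)
    have hFE := congrArg (· * phi p (gen p .Ki)) (phi_F_mul_phi_E p)
    simp only [sub_mul, smul_mul_assoc, mul_assoc, phi_K_Ki, mul_one, one_mul] at hEF hFE
    revert i
    simp [forall_fin_three, act_F, x_zero, x_one, x_two, rho, vecRep_F,
      -Complex.coe_smul, -inv_pow, mul_sub, sub_mul, hKF, hEF, hFE, mul_assoc, phi_K_Ki, hd', hq]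
    constructor <;> match_scalars <;> field_simp <;> (try rw [hr]) <;>
      (try field_simp) <;> ring
  · revert i
    simp [forall_fin_three, act_K, x_zero, x_one, x_two, rho, vecRep_K,
      -Complex.coe_smul, -inv_pow, mul_sub, sub_mul, hKE, hKF, mul_assoc, phi_K_Ki]
    constructor <;> match_scalars <;> ring
  · have hKiE : phi p (gen p .Ki) * (phi p (gen p .E) * phi p (gen p .K))
        = (p.q : ℂ)⁻¹ • phi p (gen p .E) := by
      rw [← mul_assoc, phi_Ki_E, smul_mul_assoc, mul_assoc, phi_Ki_K, mul_one]
    have hKiF : phi p (gen p .Ki) * (phi p (gen p .F) * phi p (gen p .K))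
        = (p.q : ℂ) • phi p (gen p .F) := by
      rw [← mul_assoc, phi_Ki_F, smul_mul_assoc, mul_assoc, phi_Ki_K, mul_one]
    have hKiK (z : Mat p) : phi p (gen p .Ki) * (phi p (gen p .K) * z) = z := by
      rw [← mul_assoc, phi_Ki_K, one_mul]
    revert i
    simp [forall_fin_three, act_Ki, x_zero, x_one, x_two, rho, vecRep_Ki,
      -Complex.coe_smul, -inv_pow, mul_sub, sub_mul, hKiE, hKiF, hKiK, mul_assoc, phi_Ki_K]
    constructor <;> match_scalars <;> ring

/-- The generators `x_i` span a copy of the vector representation. -/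
lemma act_x (g : U p) (i : Fin 3) : act p g (x p i) = ∑ j, rho p j i g • x p j := by
  have hrho (j i : Fin 3) (g : U p) : rho p j i g = vecRep p g j i := rfl
  induction g using U_induction p generalizing i with
  | hc c =>
    simp only [hrho, AlgHom.commutes, Matrix.algebraMap_matrix_apply, ite_smul, zero_smul,
      Finset.sum_ite_eq', Finset.mem_univ, if_true, Module.algebraMap_end_apply]
    rfl
  | hg y => exact act_gen_x p y i
  | hm a b ha hb =>
    simp only [map_mul, Module.End.mul_apply, hb, map_sum, map_smul, ha, hrho, Finset.smul_sum,
      Matrix.mul_apply, Finset.sum_smul, smul_smul]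
    rw [Finset.sum_comm]
    simp only [mul_comm]
  | ha a b ha hb =>
    simp only [map_add, LinearMap.add_apply, ha, hb, add_smul, Finset.sum_add_distrib]

lemma sum_eps_x (k : Fin 3) :
    ∑ i, ∑ j, (eps p i j k : ℂ) • (x p i * x p j) = (p.Lam : ℂ) • x p k := by
  have hs := s_ne p
  have hd := sq_sub_one_ne p
  have hr : (p.r : ℂ) ^ 2 = p.s + (p.s : ℂ)⁻¹ := by exact_mod_cast (sq p.r).trans (r_sq p)
  have hq := q_eq p
  have hd' := d_inv p
  simp only [Fin.sum_univ_three, Lam_eq]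
  revert k
  simp [forall_fin_three, eps, x_zero, x_one, x_two, -Complex.coe_smul,
    -inv_pow, mul_sub, sub_mul,
    phi_K_E, phi_K_F, phi_E_mul_phi_F, phi_F_mul_phi_E, hd', hq]
  refine ⟨?_, ?_, ?_⟩ <;> match_scalars <;> field_simp <;> (try rw [hr]) <;>
      (try field_simp) <;> ring

lemma sum_metric_x :
    ∑ i, ∑ j, (metric p i j : ℂ) • (x p i * x p j) = ((p.R ^ 2 : ℝ) : ℂ) • (1 : Mat p) := by
  have hs := s_ne p
  have hd := sq_sub_one_ne p
  have hr : (p.r : ℂ) ^ 2 = p.s + (p.s : ℂ)⁻¹ := by exact_mod_cast (sq p.r).trans (r_sq p)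
  have hd' := d_inv p
  simp only [Fin.sum_univ_three, ← c_sq]
  simp [metric, x_zero, x_one, x_two, -Complex.coe_smul,
    -inv_pow, mul_sub, sub_mul,
    phi_E_mul_phi_F, phi_F_mul_phi_E, hd']
  match_scalars <;> field_simp <;> (try rw [hr]) <;>
      (try field_simp) <;> ring

/-! ### The braided tensor product -/

variable {p} {M : ℕ}

lemma copy_mul_copy {α β : Fin M} (h : α < β) (a b : Mat p) :
    copy p M β b * copy p M α a
      = LinearMap.mul' ℂ (Braided p M) (TensorProduct.map
          ((copy p M α).toLinearMap ∘ₗ (act p).toLinearMap.flip a ∘ₗ antipode p)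
          ((copy p M β).toLinearMap ∘ₗ (act p).toLinearMap.flip b) (univR p p.N)) := by
  have hrel := RingQuot.mkAlgHom_rel ℂ (BraidRel.cross (p := p) α β h a b)
  rw [map_mul] at hrel
  refine hrel.trans ?_
  generalize univR p p.N = t
  induction t using TensorProduct.induction_on with
  | zero => simp
  | tmul u v => simp [copy]
  | add u v hu hv => simp only [map_add, hu, hv]

/-- Moving a generator `x_i` of a copy to the right past any element of an earlier copy. -/
lemma copy_x_mul_copy {α β : Fin M} (h : α < β) (a : Mat p) (i : Fin 3) :
    copy p M β (x p i) * copy p M α a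
      = ∑ j, copy p M α (act p (antipode p (lU p j i)) a) * copy p M β (x p j) := by
  rw [copy_mul_copy h]
  refine map_rho_univR p p.N_pos _ _ (fun j => copy p M β (x p j)) i fun u => ?_
  simp [act_x, -Complex.coe_smul]

lemma sum_antipode_lU_mul_lU (i j : Fin 3) :
    ∑ k, antipode p (lU p i k) * lU p k j = if i = j then 1 else 0 := by
  simp only [antipode_lU]
  exact (isBorel p).lMatInv_mul_lMat i j

lemma y_eq [NeZero M] {α : Fin M} (hα : 0 < α) (i : Fin 3) :
    y p M α i = ∑ j, copy p M α (x p j) * copy p M 0 (phi p (lU p j i)) := by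
  rw [y, if_neg hα.ne']
  simp only [Lplus_eq]

/-- The new generators of the later copies commute with the whole first copy: the element
`φ₁(L⁺)` undoes the braiding of `x_α` with the first copy. -/
lemma y_mul_copy [NeZero M] {α : Fin M} (hα : 0 < α) (i : Fin 3) (a : Mat p) :
    y p M α i * copy p M 0 a = copy p M 0 a * y p M α i := by
  calc y p M α i * copy p M 0 a
      = ∑ j, ∑ k, copy p M α (x p j) * copy p M 0 (act p (lU p j k) a)
          * copy p M 0 (phi p (lU p k i)) := by
        simp only [y_eq hα, Finset.sum_mul, mul_assoc, ← map_mul, phi_lU_mul, map_sum,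
          Finset.mul_sum]
    _ = ∑ k, ∑ l, copy p M 0 (act p (∑ j, antipode p (lU p l j) * lU p j k) a)
          * copy p M α (x p l) * copy p M 0 (phi p (lU p k i)) := by
        simp only [copy_x_mul_copy hα, map_sum, map_mul, LinearMap.sum_apply,
          Module.End.mul_apply, Finset.sum_mul]
        rw [Finset.sum_comm]
        exact Finset.sum_congr rfl fun k _ => Finset.sum_comm
    _ = copy p M 0 a * y p M α i := by
        simp only [sum_antipode_lU_mul_lU, y_eq hα, Finset.mul_sum, mul_assoc]
        refine Finset.sum_congr rfl fun k _ => ?_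
        rw [Finset.sum_eq_single k (fun l _ hl => by simp [hl]) (by simp)]
        simp

/-- Normal ordering of a product of two of the new generators. -/
lemma y_mul_y [NeZero M] {α β : Fin M} (hα : 0 < α) (hβ : 0 < β) (i j : Fin 3) :
    y p M α i * y p M β j = ∑ k, ∑ l, copy p M α (x p k) * copy p M β (x p l)
      * copy p M 0 (phi p (lU p l j * lU p k i)) := by
  rw [y_eq hα, Finset.sum_mul]
  refine Finset.sum_congr rfl fun k _ => ?_
  rw [mul_assoc, ← y_mul_copy hβ, y_eq hβ, Finset.sum_mul, Finset.mul_sum]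
  simp only [mul_assoc, map_mul]

lemma sum_comm_pairs {ι B : Type*} [Fintype ι] [AddCommMonoid B] (F : ι → ι → ι → ι → B) :
    ∑ i, ∑ j, ∑ k, ∑ l, F i j k l = ∑ k, ∑ l, ∑ i, ∑ j, F i j k l := by
  rw [Finset.sum_congr rfl fun i _ => Finset.sum_comm, Finset.sum_comm]
  refine Finset.sum_congr rfl fun k _ => ?_
  rw [Finset.sum_congr rfl fun i _ => Finset.sum_comm, Finset.sum_comm]

lemma sum_smul_y_mul_y [NeZero M] {α β : Fin M} (hα : 0 < α) (hβ : 0 < β)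
    (t : Fin 3 → Fin 3 → ℂ) :
    ∑ i, ∑ j, t i j • (y p M α i * y p M β j)
      = ∑ k, ∑ l, copy p M α (x p k) * copy p M β (x p l) * copy p M 0 (phi p
          (∑ i, ∑ j, t i j • (lU p l j * lU p k i))) := by
  simp only [y_mul_y hα hβ, Finset.smul_sum, map_sum, map_smul, Finset.mul_sum, mul_smul_comm]
  exact sum_comm_pairs _

/-- The relations of the fuzzy sphere are covariant, hence pass to the new generators. -/
lemma sum_eps_y [NeZero M] (α : Fin M) (m : Fin 3) :
    ∑ i, ∑ j, (eps p i j m : ℂ) • (y p M α i * y p M α j) = (p.Lam : ℂ) • y p M α m := by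
  rcases (Fin.zero_le α).eq_or_lt with h | hα
  · have h1 := congrArg (copy p M 0) (sum_eps_x p m)
    simpa [← h, y, -Complex.coe_smul] using h1
  · calc ∑ i, ∑ j, (eps p i j m : ℂ) • (y p M α i * y p M α j)
        = ∑ k, ∑ l, ∑ n, (eps p k l n : ℂ) • (copy p M α (x p k) * copy p M α (x p l)
            * copy p M 0 (phi p (lU p n m))) := by
          simp only [sum_smul_y_mul_y hα hα, (isBorel p).sum_eps, map_sum, map_smul,
            Finset.mul_sum, mul_smul_comm]
      _ = ∑ n, copy p M α (∑ k, ∑ l, (eps p k l n : ℂ) • (x p k * x p l))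
            * copy p M 0 (phi p (lU p n m)) := by
          simp only [map_sum, map_smul, map_mul, Finset.sum_mul, smul_mul_assoc]
          rw [Finset.sum_congr rfl fun k _ => Finset.sum_comm, Finset.sum_comm]
      _ = (p.Lam : ℂ) • y p M α m := by
          simp only [sum_eps_x, y_eq hα, map_smul, smul_mul_assoc, Finset.smul_sum]

lemma sum_metric_y [NeZero M] (α : Fin M) :
    ∑ i, ∑ j, (metric p i j : ℂ) • (y p M α i * y p M α j)
      = ((p.R ^ 2 : ℝ) : ℂ) • (1 : Braided p M) := by
  have hx := congrArg (copy p M α) (sum_metric_x p)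
  simp only [map_sum, map_smul, map_mul, map_one] at hx
  rw [← hx]
  rcases (Fin.zero_le α).eq_or_lt with h | hα
  · simp only [← h, y, if_true]
  · simp only [sum_smul_y_mul_y hα hα, (isBorel p).sum_metric, map_smul, map_one,
      mul_smul_comm, mul_one]

/-- The cross relations between the generators of two copies, solved for the opposite order. -/
lemma sum_rMat_copy_x [NeZero M] {α β : Fin M} (h : α < β) (i j : Fin 3) :
    ∑ a, ∑ b, rMat (p.s : ℂ) a j b i • (copy p M β (x p a) * copy p M α (x p b))
      = copy p M α (x p i) * copy p M β (x p j) := by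
  calc ∑ a, ∑ b, rMat (p.s : ℂ) a j b i • (copy p M β (x p a) * copy p M α (x p b))
      = ∑ a, copy p M β (x p a) * copy p M α (act p (lU p a j) (x p i)) := by
        simp only [act_x, rho_lU, map_sum, map_smul, Finset.mul_sum, mul_smul_comm]
    _ = ∑ c, copy p M α (act p (∑ a, antipode p (lU p c a) * lU p a j) (x p i))
          * copy p M β (x p c) := by
        simp only [copy_x_mul_copy h, map_sum, map_mul, LinearMap.sum_apply,
          Module.End.mul_apply, Finset.sum_mul]
        exact Finset.sum_comm
    _ = copy p M α (x p i) * copy p M β (x p j) := by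
        simp only [sum_antipode_lU_mul_lU]
        rw [Finset.sum_eq_single j (fun l _ hl => by simp [hl]) (by simp)]
        simp

/-- The exchange relations: `RLL` moves the braid matrix from the `y`'s to the `x`'s, where it
cancels the braiding of the two copies. -/
lemma y_mul_y_eq_sum_Rhat [NeZero M] {α β : Fin M} (hα : 0 < α) (h : α < β) (i j : Fin 3) :
    y p M α i * y p M β j
      = ∑ h, ∑ k, Rhat p h k i j • (y p M β h * y p M α k) := by
  have hβ := hα.trans h
  symm
  calc ∑ h, ∑ k, Rhat p h k i j • (y p M β h * y p M α k)
      = ∑ a, ∑ b, ∑ h, ∑ k, rMat (p.s : ℂ) a h b k • (copy p M β (x p a) * copy p M α (x p b)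
          * copy p M 0 (phi p (lU p h j * lU p k i))) := by
        simp only [Rhat_eq, sum_smul_y_mul_y hβ hα, (isBorel p).rMat_lMat_lMat, map_sum, map_smul,
          Finset.mul_sum, mul_smul_comm]
    _ = ∑ h, ∑ k, (∑ a, ∑ b, rMat (p.s : ℂ) a h b k • (copy p M β (x p a) * copy p M α (x p b)))
          * copy p M 0 (phi p (lU p h j * lU p k i)) := by
        simp only [Finset.sum_mul, smul_mul_assoc]
        exact sum_comm_pairs _
    _ = y p M α i * y p M β j := by
        simp only [sum_rMat_copy_x h, y_mul_y hα hβ]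
        exact Finset.sum_comm

end FuzzySphere

end

theorem corollary3 (p : FuzzySphere.Params) (M : ℕ) [NeZero M] :
    (∀ (α : Fin M) (k : Fin 3),
      ∑ i, ∑ j, (FuzzySphere.eps p i j k : ℂ) •
          (FuzzySphere.y p M α i * FuzzySphere.y p M α j)
        = (p.Lam : ℂ) • FuzzySphere.y p M α k) ∧
    (∀ α : Fin M,
      ∑ i, ∑ j, (FuzzySphere.metric p i j : ℂ) •
          (FuzzySphere.y p M α i * FuzzySphere.y p M α j)
        = ((p.R ^ 2 : ℝ) : ℂ) • (1 : FuzzySphere.Braided p M)) ∧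
    (∀ α : Fin M, 0 < α → ∀ i j : Fin 3,
      Commute (FuzzySphere.y p M 0 i) (FuzzySphere.y p M α j)) ∧
    (∀ α β : Fin M, 0 < α → α < β → ∀ i j : Fin 3,
      FuzzySphere.y p M α i * FuzzySphere.y p M β j
        = ∑ h, ∑ k, FuzzySphere.Rhat p h k i j •
            (FuzzySphere.y p M β h * FuzzySphere.y p M α k)) := by
  refine ⟨FuzzySphere.sum_eps_y, FuzzySphere.sum_metric_y, fun α hα i j => ?_,
    fun α β hα h i j => FuzzySphere.y_mul_y_eq_sum_Rhat hα h i j⟩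
  have h := FuzzySphere.y_mul_copy hα j (FuzzySphere.x p i)
  rw [FuzzySphere.y, if_pos rfl]
  exact h.symm
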